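/- Theorem 1.1. Let $J$ be an interval of times with $0=\min J$, for instance $J=[0,T]$ or $J=[0,\infty)$, and let $\lambda:J\to\mathbb R$ belong to Lip$(1/2)$, i.e. $|\lambda(t)-\lambda(s)|\le C|t-s|^{1/2}$ for all $s,t\in J$ and some constant $C$; the smallest such $C\ge 0$ is denoted $\|\lambda\|_{1/2}$. Let $\mathbb H=\{z\in\mathbb C:\operatorname{Im} z>0\}$, and for $t\in J$ let $K_t$ be the Loewner hull driven by $\lambda$, that is, the set of those $z\in\mathbb H$ for which the initial value problem $$\partial_s g_s(z)=\frac{2}{g_s(z)-\lambda(s)},\qquad g_0(z)=z,$$ has no solution on the whole closed time interval $[0,t]$. Suppose that $\lambda$ generates a curve $\gamma$, i.e. $\gamma:J\to\overline{\mathbb H}$ is continuous and, for every $t\in J$, $K_t$ is the complement in $\mathbb H$ of the unbounded connected component of $\mathbb H\setminus\gamma[0,t]$. If the image $\gamma(J)$ has non-empty interior in $\mathbb C$, then $$\|\lambda\|_{1/2}\ge 4.0001.$$ -/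

import Mathlib

open Set

/-- The open upper half-plane, as a subset of `ℂ`. -/
def upperHP : Set ℂ := {z : ℂ | 0 < z.im}

/-- `g` solves the chordal Loewner equation driven by `lam`, started from `z`,
on the closed time interval `[0, t]`:
`∂ₛ g(s) = 2 / (g(s) - lam(s))`, `g(0) = z`, where `g(s) - lam(s)` never vanishes. -/
structure IsLoewnerSolution (lam : ℝ → ℝ) (z : ℂ) (t : ℝ) (g : ℝ → ℂ) : Prop where
  init : g 0 = z
  ne_driving : ∀ s ∈ Icc (0 : ℝ) t, g s ≠ (lam s : ℂ)
  deriv : ∀ s ∈ Icc (0 : ℝ) t,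
    HasDerivWithinAt g (2 / (g s - (lam s : ℂ))) (Icc 0 t) s

/-- The Loewner hull `K_t` driven by `lam`: the points `z` of the upper half-plane whose
lifetime `T_z` is at most `t`, i.e. for which the Loewner equation started at `z` has no
solution up to and including time `t`. It depends only on `lam` on `[0, t]`. -/
def loewnerHull (lam : ℝ → ℝ) (t : ℝ) : Set ℂ :=
  {z ∈ upperHP | ¬ ∃ g : ℝ → ℂ, IsLoewnerSolution lam z t g}

/-- The union of the unbounded connected components of `ℍ \ A`. There is exactly one such
component when `A` is bounded. (`connectedComponentIn S z` is empty for `z ∉ S`.) -/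
def unboundedComponent (A : Set ℂ) : Set ℂ :=
  {z : ℂ | ¬ Bornology.IsBounded (connectedComponentIn (upperHP \ A) z)}

/-- The driving function `lam` on the time interval `J` (with least element `0`) generates the
curve (trace) `γ`: the map `γ` is continuous from `J` to the closed upper half-plane and, for
each `t ∈ J`, the hull `K_t` is `γ[0, t]` filled in, i.e. it is the complement in the upper
half-plane of the unbounded component of `ℍ \ γ[0, t]`. -/
structure GeneratesCurve (lam : ℝ → ℝ) (J : Set ℝ) (γ : ℝ → ℂ) : Prop where
  continuousOn : ContinuousOn γ J
  im_nonneg : ∀ t ∈ J, 0 ≤ (γ t).im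
  hull_eq : ∀ t ∈ J, loewnerHull lam t = upperHP \ unboundedComponent (γ '' Icc 0 t)

/-! Suppose the norm is below `4.0001` and the curve fills a disc. The proof rests on the rigidity
of real trajectories when the Hölder constant is close to 4. Seen backwards from capture, the
displacement `D` of a trajectory satisfies `D' = 2/(l - D)` with `l ≤ c√τ`. Along `D = β√τ` the
ratio `D/√τ` is forced upwards unless `β(c - β) ≥ 4`. For `c < 4` this never happens and there is no
capture; for `c = 4.0001` it confines `D/√τ` to a small neighbourhood of 2 on all scales far from
the ends of the path.

Now let two such paths, driven by the same function, be captured one unit of time apart. Backwards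
in time their difference grows at least like the cube root of `r`. But both displacements are close
to `2√r`, so the difference is at most about 4 plus a small multiple of `√r`. On a long enough path
this is absurd (`CapturedPath.false_of_pair`). Hence capture times that are bounded away from the
starting time `t` are uniformly separated, and there are only countably many after `t`
(`countable_of_capture`). All this tolerates small errors, so it applies to complex trajectories
that are almost real.

In a filled disc every point is visited at the time when it is swallowed (`apply_lifetime_eq`). At a
suitable time `t` uncountably many points of the disc are swallowed while some survive; as a
countable set does not separate a disc, the hull has uncountably many boundary points `q` there.
Surviving trajectories that start near `q` are almost real at time `t` (`exists_im_lt`), and stay so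
until they come hyperbolically close to the driving function or are about to be swallowed. In either
case some point near `q` is swallowed at about that time; the first case uses the Schwarz–Pick lemma
and the expansion of the hyperbolic metric by the flow (`exists_swallowed_near`). In the limit `q =
γ S`, where `S` is `t` or a limit of almost real captures (`exists_capture_time`). There are only
countably many such `S`, hence countably many `q`: a contradiction. -/

open scoped ComplexConjugate NNReal Topology

/-! ### Trajectories captured by a driving function of small Hölder norm -/

/-- A trajectory seen backwards from the time of its (near) capture: `D τ` is the displacement
during the last `τ` units of time, `l τ` the displacement of the driving function, and `η` the
final distance, so that `η + l τ - D τ` is the distance to the driving function. -/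
structure CapturedPath (l D D' : ℝ → ℝ) (η A : ℝ) : Prop where
  zero : D 0 = 0
  cont : ContinuousOn D (Icc 0 A)
  deriv : ∀ τ ∈ Ioo 0 A, HasDerivAt D (D' τ) τ
  pos : ∀ τ ∈ Ioo 0 A, 0 < η + l τ - D τ
  lower : ∀ τ ∈ Ioo 0 A, 1.999998 / (η + l τ - D τ) ≤ D' τ
  upper : ∀ τ ∈ Ioo 0 A, D' τ ≤ 2 / (η + l τ - D τ)
  l_le : ∀ τ ∈ Ioo 0 A, l τ ≤ 4.0001 * √τ

namespace CapturedPath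

variable {l D D' : ℝ → ℝ} {η A : ℝ}

theorem nonneg (h : CapturedPath l D D' η A) {τ : ℝ} (hτ : τ ∈ Icc 0 A) : 0 ≤ D τ := by
  have hm : MonotoneOn D (Icc 0 A) := by
    apply monotoneOn_of_hasDerivWithinAt_nonneg (convex_Icc 0 A) h.cont (f' := D')
    · intro x hx
      rw [interior_Icc] at hx
      exact (h.deriv x hx).hasDerivWithinAt
    · intro x hx
      rw [interior_Icc] at hx
      have := h.pos x hx
      exact le_trans (by positivity) (h.lower x hx)
  have := hm ⟨le_refl 0, hτ.1.trans hτ.2⟩ hτ hτ.1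
  rwa [h.zero] at this

/-- With exact constants the claim is `β(4 - β) < 4`, that is `(β - 2)² > 0`. At distance `0.02`
from 2 the margin pays for the excess of the Hölder constant over 4, for `η`, and for the extra
slope `1e-5/√τ` that lets the barrier coefficient grow logarithmically. -/
theorem deriv_gt (h : CapturedPath l D D' η A) {τ β : ℝ} (hτ : τ ∈ Ioo 0 A)
    (hη : η ≤ 1e-5 * √τ) (hβ : β ≤ 1.98 ∨ 2.02 ≤ β) (hD : D τ = √τ * β) :
    1 / (2 * √τ) * β + √τ * (1e-5 / τ) < D' τ := by
  have hs : 0 < √τ := Real.sqrt_pos.2 hτ.1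
  have hsq : √τ * √τ = τ := Real.mul_self_sqrt hτ.1.le
  have hβ0 : 0 ≤ β := by
    have := h.nonneg ⟨hτ.1.le, hτ.2.le⟩
    rw [hD] at this
    exact nonneg_of_mul_nonneg_right this hs
  have hu := h.pos τ hτ
  have hl := h.l_le τ hτ
  have hu' : η + l τ - D τ ≤ √τ * (4.00011 - β) := by rw [hD]; nlinarith
  have hv : 0 < 4.00011 - β := by
    have := hu.trans_le hu'
    exact pos_of_mul_pos_right this hs.le
  have hlow : 1.999998 / (√τ * (4.00011 - β)) ≤ D' τ :=
    le_trans (by gcongr) (h.lower τ hτ)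
  refine lt_of_lt_of_le ?_ hlow
  have e1 : 1 / (2 * √τ) * β + √τ * (1e-5 / τ) = (β / 2 + 1e-5) / √τ := by
    rw [show (1e-5 : ℝ) / τ = 1e-5 / (√τ * √τ) by rw [hsq]]
    field_simp
  rw [e1, div_lt_div_iff₀ hs (by positivity)]
  have key : (β / 2 + 1e-5) * (4.00011 - β) < 1.999998 := by
    rcases hβ with hβ | hβ <;> nlinarith
  nlinarith

theorem hasDerivAt_barrier {κ τ₁ x : ℝ} (hx : 0 < x) (hτ₁ : 0 < τ₁) :
    HasDerivAt (fun τ => √τ * (κ + 1e-5 * Real.log (τ / τ₁)))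
      (1 / (2 * √x) * (κ + 1e-5 * Real.log (x / τ₁)) + √x * (1e-5 / x)) x := by
  have h1 := (Real.hasDerivAt_sqrt hx.ne')
  have h2 : HasDerivAt (fun τ => κ + 1e-5 * Real.log (τ / τ₁)) (1e-5 / x) x := by
    have := ((((hasDerivAt_id x).div_const τ₁).log (by simp; exact ⟨hx.ne', hτ₁.ne'⟩)).const_mul
      1e-5).const_add κ
    refine this.congr_deriv ?_
    simp
    field_simp
  exact h1.mul h2

theorem barrier_le (h : CapturedPath l D D' η A) {κ τ₀ τ₁ a b : ℝ} (hτ₁ : 0 < τ₁) (ha : 0 < a)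
    (hη : η ≤ 1e-5 * √a) (hb : b < A)
    (hκ : ∀ x ∈ Icc a b, κ + 1e-5 * Real.log (x / τ₁) ≤ 1.98 ∨
      2.02 ≤ κ + 1e-5 * Real.log (x / τ₁))
    (hstart : √a * (κ + 1e-5 * Real.log (a / τ₁)) ≤ D a) (h₀ : τ₀ ∈ Icc a b) :
    √τ₀ * (κ + 1e-5 * Real.log (τ₀ / τ₁)) ≤ D τ₀ := by
  refine image_le_of_deriv_right_lt_deriv_boundary'
    (f := fun τ => √τ * (κ + 1e-5 * Real.log (τ / τ₁))) (a := a) (b := b)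
    (f' := fun x => 1 / (2 * √x) * (κ + 1e-5 * Real.log (x / τ₁)) + √x * (1e-5 / x))
    (B := D) (B' := D') ?_ ?_ hstart ?_ ?_ ?_ h₀
  · intro x hx
    exact (hasDerivAt_barrier (ha.trans_le hx.1) hτ₁).continuousAt.continuousWithinAt
  · intro x hx
    exact (hasDerivAt_barrier (ha.trans_le hx.1) hτ₁).hasDerivWithinAt
  · exact h.cont.mono (Icc_subset_Icc ha.le hb.le)
  · intro x hx
    exact (h.deriv x ⟨ha.trans_le hx.1, hx.2.trans hb⟩).hasDerivWithinAt
  · intro x hx hxD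
    refine h.deriv_gt ⟨ha.trans_le hx.1, hx.2.trans hb⟩ ?_ (hκ x ⟨hx.1, hx.2.le⟩) hxD.symm
    have := Real.sqrt_le_sqrt hx.1
    linarith

/-- The barrier coefficient gains `1e-5` per unit of `log τ`. Over the factor `exp 200000` it gains
2, so a barrier ending at `1.98` starts below zero, hence below `D`. -/
theorem le_displacement (h : CapturedPath l D D' η A) {τ₀ τ : ℝ} (hτ₀ : 0 < τ₀)
    (hτ : τ₀ * Real.exp 200000 ≤ τ) (hA : τ < A) (hη : η ≤ 1e-5 * √τ₀) :
    1.98 * √τ ≤ D τ := by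
  have h1 : τ₀ ≤ τ := by
    have := Real.one_le_exp (show (0:ℝ) ≤ 200000 by norm_num)
    nlinarith
  have hτp : 0 < τ := hτ₀.trans_le h1
  have hlog : Real.log (τ₀ / τ) ≤ -200000 := by
    rw [Real.log_div hτ₀.ne' hτp.ne']
    have := Real.log_le_log (by positivity) hτ
    rw [Real.log_mul hτ₀.ne' (Real.exp_ne_zero _), Real.log_exp] at this
    linarith
  have := h.barrier_le (κ := 1.98) (τ₀ := τ) (τ₁ := τ) (a := τ₀) (b := τ) hτp hτ₀ hη hA ?_ ?_
    ⟨h1, le_rfl⟩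
  · rw [div_self hτp.ne', Real.log_one] at this
    linarith
  · intro x hx
    left
    have : Real.log (x / τ) ≤ 0 :=
      Real.log_nonpos (div_nonneg (hτ₀.le.trans hx.1) hτp.le) ((div_le_one hτp).2 hx.2)
    linarith
  · have h2 := h.nonneg (τ := τ₀) ⟨hτ₀.le, h1.trans hA.le⟩
    have h3 : 1.98 + 1e-5 * Real.log (τ₀ / τ) ≤ 0 := by linarith
    nlinarith [Real.sqrt_nonneg τ₀]

/-- A ratio above `2.02` would rise to `4.02` within the factor `exp 200000`, leaving no positive
distance to a driving function bounded by `4.0001 √τ`. -/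
theorem displacement_le (h : CapturedPath l D D' η A) {τ : ℝ} (hτ : 0 < τ)
    (hA : τ * Real.exp 200000 < A) (hη : η ≤ 1e-5 * √τ) :
    D τ ≤ 2.02 * √τ := by
  by_contra hcon
  push Not at hcon
  set b := τ * Real.exp 200000
  have h1 : τ ≤ b := by
    have := Real.one_le_exp (show (0:ℝ) ≤ 200000 by norm_num)
    nlinarith
  have hb : 0 < b := hτ.trans_le h1
  have hlog : Real.log (b / τ) = 200000 := by
    rw [show b / τ = Real.exp 200000 by simp only [b]; field_simp, Real.log_exp]
  have := h.barrier_le (κ := 2.02) (τ₀ := b) (τ₁ := τ) (a := τ) (b := b) hτ hτ hη hA ?_ ?_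
    ⟨h1, le_rfl⟩
  · rw [hlog] at this
    have h2 := h.pos b ⟨hb, hA⟩
    have h3 := h.l_le b ⟨hb, hA⟩
    have h4 := Real.sqrt_le_sqrt h1
    nlinarith [Real.sqrt_pos.2 hb]
  · intro x hx
    right
    have : 0 ≤ Real.log (x / τ) := Real.log_nonneg ((one_le_div hτ).2 hx.1)
    linarith
  · rw [div_self hτ.ne', Real.log_one]
    linarith

end CapturedPath

namespace CapturedPath

variable {l D D' : ℝ → ℝ} {η A : ℝ}

theorem dist_le (h : CapturedPath l D D' η A) (hA : 711 * Real.exp 200000 < A)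
    (hη : η ≤ 1e-6 * Real.exp (-100000)) {τ : ℝ} (hτ : 0.01 ≤ τ) (hτ' : τ ≤ 711) :
    1.98 * √τ ≤ D τ ∧ D τ ≤ 2.02 * √τ ∧ η + l τ - D τ ≤ 2.0202 * √τ := by
  have he := Real.one_le_exp (show (0:ℝ) ≤ 200000 by norm_num)
  have hτp : 0 < τ := by linarith
  have hs : (0.1 : ℝ) ≤ √τ := Real.le_sqrt_of_sq_le (by norm_num; linarith)
  have he' : Real.exp (-100000) ≤ 1 := Real.exp_le_one_iff.2 (by norm_num)
  have hητ : η ≤ 1e-5 * √τ := by linarith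
  have hτA : τ < A := by nlinarith
  have hsq : √(0.01 * Real.exp (-200000)) = 0.1 * Real.exp (-100000) := by
    rw [Real.sqrt_eq_iff_mul_self_eq (by positivity) (by positivity)]
    rw [show (-200000 : ℝ) = -100000 + -100000 by norm_num, Real.exp_add]
    ring
  have h1 : 1.98 * √τ ≤ D τ := by
    refine h.le_displacement (τ₀ := 0.01 * Real.exp (-200000)) (by positivity) ?_ hτA ?_
    · rw [mul_assoc, ← Real.exp_add]
      norm_num
      linarith
    · rw [hsq]; linarith
  refine ⟨h1, h.displacement_le hτp ?_ hητ, ?_⟩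
  · nlinarith
  · have := h.l_le τ ⟨hτp, hτA⟩
    linarith

/-- Two captured paths with the same driving function cannot be captured at times whose difference
is small compared to their length. Time is normalized so that this difference is `1`. -/
theorem false_of_pair {l₁ D₁ D₁' l₂ D₂ D₂' : ℝ → ℝ} {η₁ η₂ A L : ℝ}
    (h₁ : CapturedPath l₁ D₁ D₁' η₁ A) (h₂ : CapturedPath l₂ D₂ D₂' η₂ A)
    (hA : 711 * Real.exp 200000 < A)
    (hη₁ : η₁ ≤ 1e-6 * Real.exp (-100000)) (hη₂ : η₂ ≤ 1e-6 * Real.exp (-100000))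
    (hη₁' : 0 ≤ η₁)
    (hl : ∀ r ∈ Ioo 0 711, l₂ (1 + r) = L + l₁ r) (hL : L ≤ 4.0001) : False := by
  have he := Real.one_le_exp (show (0:ℝ) ≤ 200000 by norm_num)
  have he' : Real.exp (-100000) ≤ 1 := Real.exp_le_one_iff.2 (by norm_num)
  have hA' : 711 < A := by nlinarith
  have hu₁ : ∀ r : ℝ, 0 < r → r ≤ 711 → η₁ + l₁ r - D₁ r ≤ 2.0202 * √r ∨
      (r ≤ 0.01 ∧ η₁ + l₁ r - D₁ r ≤ 0.4002) := by
    intro r hr hr'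
    rcases le_total r 0.01 with h | h
    · right
      refine ⟨h, ?_⟩
      have h3 := h₁.l_le r ⟨hr, by linarith⟩
      have h4 := h₁.nonneg (τ := r) ⟨hr.le, by linarith⟩
      have h5 : √r ≤ 0.1 := Real.sqrt_le_iff.2 ⟨by norm_num, by norm_num; linarith⟩
      linarith
    · left
      exact (h₁.dist_le hA hη₁ h hr').2.2
  set Δ : ℝ → ℝ := fun r => η₂ - η₁ + L + D₁ r - D₂ (1 + r) with hΔ
  have hΔu : ∀ r ∈ Ioo (0:ℝ) 711, Δ r = (η₂ + l₂ (1 + r) - D₂ (1 + r)) - (η₁ + l₁ r - D₁ r) := by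
    intro r hr
    rw [hl r hr]; simp only [hΔ]; ring
  -- the two paths are at a definite distance at some time
  obtain ⟨r₀, hr₀, hΔ₀⟩ : ∃ r ∈ Ioo (0:ℝ) 0.21, 0.8 ≤ Δ r := by
    -- The bounds on `D₂` at 1 and `1.21 = 1.1²` keep its mean slope below `1.153`, so at some `c`
    -- in between the second path is at distance at least `1.735`. The first path, less than `0.21`
    -- from its end, is at distance below `0.93`.
    obtain ⟨c, hc, hcd⟩ := exists_hasDerivAt_eq_slope D₂ D₂' (show (1:ℝ) < 1.21 by norm_num)
      (h₂.cont.mono (Icc_subset_Icc (by norm_num) (by linarith)))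
      (fun x hx => h₂.deriv x ⟨by linarith [hx.1], by linarith [hx.2]⟩)
    have hcm : c - 1 ∈ Ioo (0:ℝ) 0.21 := ⟨by linarith [hc.1], by linarith [hc.2]⟩
    refine ⟨c - 1, hcm, ?_⟩
    rw [hΔu _ ⟨hcm.1, by linarith [hcm.2]⟩, show 1 + (c - 1) = c by ring]
    have w1 := (h₂.dist_le hA hη₂ (τ := 1) (by norm_num) (by norm_num)).1
    have w2 := (h₂.dist_le hA hη₂ (τ := 1.21) (by norm_num) (by norm_num)).2.1
    rw [show (1.21:ℝ) = 1.1 ^ 2 by norm_num, Real.sqrt_sq (by norm_num)] at w2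
    rw [Real.sqrt_one] at w1
    have hcI : c ∈ Ioo 0 A := ⟨by linarith [hc.1], by linarith [hc.2]⟩
    have hp := h₂.pos c hcI
    have hlow := h₂.lower c hcI
    rw [hcd, div_le_div_iff₀ hp (by norm_num)] at hlow
    norm_num at w2 hlow
    have hu2 : 1.735 ≤ η₂ + l₂ c - D₂ c := by nlinarith
    have hs : √(c - 1) ≤ 0.4583 :=
      Real.sqrt_le_iff.2 ⟨by norm_num, by norm_num; linarith [hcm.2]⟩
    rcases hu₁ (c - 1) hcm.1 (by linarith [hcm.2]) with h | h
    · linarith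
    · linarith [h.2]
  -- The true growth exponent of `Δ` is about `1/2`; `1/3` leaves room for errors. The base is at
  -- most 1 at `r₀` and equals 1000 at `709.5`. The term `2e-6 * D₁` makes up for `1.999998` in
  -- place of 2, and `0.001` dominates that term.
  have hfence : 0.79 * ((709.5 + 0.5) / 0.71 : ℝ) ^ (1 / 3 : ℝ)
      ≤ Δ 709.5 + 2e-6 * D₁ 709.5 - 0.001 := by
    refine image_le_of_deriv_right_lt_deriv_boundary'
      (f := fun r => 0.79 * ((r + 0.5) / 0.71 : ℝ) ^ (1 / 3 : ℝ)) (a := r₀) (b := 709.5)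
      (f' := fun r => (0.79 * ((r + 0.5) / 0.71 : ℝ) ^ (1 / 3 : ℝ)) / (3 * (r + 0.5)))
      (B := fun r => Δ r + 2e-6 * D₁ r - 0.001)
      (B' := fun r => (D₁' r - D₂' (1 + r)) + 2e-6 * D₁' r) ?_ ?_ ?_ ?_ ?_ ?_
      ⟨by linarith [hr₀.2], le_rfl⟩
    · apply ContinuousOn.mul continuousOn_const
      apply ContinuousOn.rpow_const (by fun_prop)
      intro x hx
      right; norm_num
    · intro x hx
      have hx0 : 0 < x + 0.5 := by linarith [hx.1, hr₀.1]
      have h1 : HasDerivAt (fun r : ℝ => (r + 0.5) / 0.71) (1 / 0.71) x :=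
        ((hasDerivAt_id x).add_const _).div_const _
      have h2 := (h1.rpow_const (p := 1 / 3) (Or.inl (by positivity))).const_mul 0.79
      refine (h2.congr_deriv ?_).hasDerivWithinAt
      rw [Real.rpow_sub_one (by positivity)]
      field_simp
    · have h1 : ((r₀ + 0.5) / 0.71 : ℝ) ^ (1 / 3 : ℝ) ≤ 1 :=
        Real.rpow_le_one (by have := hr₀.1; positivity)
          (by rw [div_le_one (by norm_num)]; linarith [hr₀.2]) (by norm_num)
      have h2 := h₁.nonneg (τ := r₀) ⟨hr₀.1.le, by linarith [hr₀.2]⟩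
      linarith
    · have c1 : ContinuousOn D₁ (Icc r₀ 709.5) :=
        h₁.cont.mono (Icc_subset_Icc hr₀.1.le (by linarith))
      have c2 : ContinuousOn (fun r => D₂ (1 + r)) (Icc r₀ 709.5) := by
        refine h₂.cont.comp (by fun_prop) ?_
        intro x hx
        exact ⟨by linarith [hx.1, hr₀.1], by linarith [hx.2]⟩
      exact (((continuousOn_const.add c1).sub c2).add (continuousOn_const.mul c1)).sub
        continuousOn_const
    · intro x hx
      have hx0 : 0 < x := hr₀.1.trans_le hx.1
      have d1 := h₁.deriv x ⟨hx0, by linarith [hx.2]⟩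
      have d2 := (h₂.deriv (1 + x) ⟨by linarith, by linarith [hx.2]⟩).comp_const_add 1 x
      exact (((d1.const_add (η₂ - η₁ + L)).sub d2).add (d1.const_mul 2e-6)
        |>.sub_const 0.001).hasDerivWithinAt
    · intro x hx hxe
      have hx0 : 0 < x := hr₀.1.trans_le hx.1
      have hI₁ : x ∈ Ioo 0 A := ⟨hx0, by linarith [hx.2]⟩
      have hI₂ : 1 + x ∈ Ioo 0 A := ⟨by linarith, by linarith [hx.2]⟩
      have hxI : x ∈ Ioo (0:ℝ) 711 := ⟨hx0, by linarith [hx.2]⟩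
      have p1 := h₁.pos x hI₁
      have p2 := h₂.pos (1 + x) hI₂
      have lo := h₁.lower x hI₁
      have up := h₂.upper (1 + x) hI₂
      have hD₁ : D₁ x ≤ 60 := by
        have hup := h₁.pos x hI₁
        have hls := h₁.l_le x hI₁
        rcases le_total x 0.01 with h | h
        · have h5 : √x ≤ 0.1 := Real.sqrt_le_iff.2 ⟨by norm_num, by norm_num; linarith⟩
          linarith
        · have h5 : √x ≤ 27 := Real.sqrt_le_iff.2 ⟨by norm_num, by norm_num; linarith [hx.2]⟩
          linarith [(h₁.dist_le hA hη₁ h (by linarith [hx.2])).2.1]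
      set u := η₁ + l₁ x - D₁ x with hu
      set v := η₂ + l₂ (1 + x) - D₂ (1 + x) with hv
      have hΔx : Δ x = v - u := hΔu x hxI
      set f := 0.79 * ((x + 0.5) / 0.71 : ℝ) ^ (1 / 3 : ℝ) with hf
      have hfpos : 0 < f := by positivity
      have hfle : f ≤ v - u := by
        rw [hΔx] at hxe
        linarith
      -- Away from zero this is `2.0202² √x √(1 + x)` and the inequality of arithmetic and geometric
      -- means.
      have hprod : u * v ≤ 4.09 * (x + 0.5) := by
        have hv' : v ≤ 2.0202 * √(1 + x) :=
          (h₂.dist_le hA hη₂ (τ := 1 + x) (by linarith) (by linarith [hx.2])).2.2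
        have s1 := Real.sqrt_nonneg (1 + x)
        have s2 := Real.sqrt_nonneg x
        have q1 := Real.mul_self_sqrt (show 0 ≤ 1 + x by linarith)
        have q2 := Real.mul_self_sqrt hx0.le
        rcases hu₁ x hx0 (by linarith [hx.2]) with h | ⟨h, h'⟩
        · have : u * v ≤ (2.0202 * √x) * (2.0202 * √(1 + x)) := by gcongr
          nlinarith [sq_nonneg (√(1 + x) - √x)]
        · have h5 : √(1 + x) ≤ 1.1 := Real.sqrt_le_iff.2 ⟨by norm_num, by norm_num; linarith⟩
          have : u * v ≤ 0.4002 * (2.0202 * 1.1) := by gcongr; linarith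
          linarith
      -- With `hprod` the left side is at least `(2/4.09) (v - u)/(x + 0.5)`, and `2/4.09 > 1/3`.
      have key : 2 * (v - u) / (u * v) ≤ D₁' x - D₂' (1 + x) + 2e-6 * D₁' x := by
        have e1 : 2 * (v - u) / (u * v) = 2 / u - 2 / v := by field_simp
        have e2 : 1.999998 / u = 2 / u - 2e-6 * (1 / u) := by field_simp; norm_num
        have e3 : 1 / u ≤ 1.999998 / u := by gcongr; norm_num
        rw [e1]
        linarith
      refine lt_of_lt_of_le ?_ key
      rw [div_lt_div_iff₀ (by linarith) (by positivity)]
      have hx5 : 0 < x + 0.5 := by linarith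
      have t1 : f * (u * v) ≤ f * (4.09 * (x + 0.5)) := by gcongr
      have t2 : f * (x + 0.5) ≤ (v - u) * (x + 0.5) := by gcongr
      have t3 : 0 < f * (x + 0.5) := by positivity
      nlinarith
  have hroot : ((709.5 + 0.5) / 0.71 : ℝ) ^ (1 / 3 : ℝ) = 10 := by
    rw [show ((709.5 + 0.5) / 0.71 : ℝ) = 10 ^ (3 : ℝ) by norm_num, ← Real.rpow_mul (by norm_num)]
    norm_num
  rw [hroot] at hfence
  have w1 := (h₁.dist_le hA hη₁ (τ := 709.5) (by norm_num) (by norm_num)).2.1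
  have w2 := (h₂.dist_le hA hη₂ (τ := 1 + 709.5) (by norm_num) (by norm_num)).1
  have s1 : √(709.5 : ℝ) ≤ √(1 + 709.5) := Real.sqrt_le_sqrt (by norm_num)
  have s2 : √(709.5 : ℝ) ≤ 27 := Real.sqrt_le_iff.2 ⟨by norm_num, by norm_num⟩
  simp only [hΔ] at hfence
  linarith

end CapturedPath

/-! ### Countability of capture times -/

/-- The function `l` has Hölder constant at most `4.0001`, for the exponent `1/2`. -/
def SmallHolder (l : ℝ → ℝ) : Prop := ∀ s t : ℝ, |l s - l t| ≤ 4.0001 * √|s - t|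

theorem SmallHolder.neg {l : ℝ → ℝ} (hl : SmallHolder l) : SmallHolder (fun s => -l s) := by
  intro s t
  rw [show -l s - -l t = -(l s - l t) by ring, abs_neg]
  exact hl s t

theorem SmallHolder.continuous {l : ℝ → ℝ} (hl : SmallHolder l) : Continuous l := by
  rw [continuous_iff_continuousAt]
  intro t
  rw [ContinuousAt, tendsto_iff_dist_tendsto_zero]
  refine squeeze_zero (fun _ => dist_nonneg) (fun s => hl s t) ?_
  have : Continuous fun s : ℝ => 4.0001 * √|s - t| := by fun_prop
  simpa using this.tendsto t

/-- `S` is a limit of times at which paths that are almost real Loewner trajectories, started at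
time `t` and lying on the right of the driving function, almost hit the driving function. -/
def RightCapture (l : ℝ → ℝ) (t S : ℝ) : Prop :=
  ∀ ε > 0, ∃ (s : ℝ) (X X' : ℝ → ℝ), |s - S| < ε ∧ ContinuousOn X (Icc t s) ∧
    (∀ r ∈ Ioo t s, HasDerivAt X (X' r) r ∧ 0 < X r - l r ∧
      1.999998 / (X r - l r) ≤ X' r ∧ X' r ≤ 2 / (X r - l r)) ∧
    0 ≤ X s - l s ∧ X s - l s ≤ ε

/-- Scaling time by `δ` and space by `√δ` preserves both the Loewner equation and the Hölder
constant. -/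
theorem capturedPath_rescale {l X X' : ℝ → ℝ} (hl : SmallHolder l) {s t δ A : ℝ} (hδ : 0 < δ)
    (hA : δ * A ≤ s - t) (hX : ContinuousOn X (Icc t s))
    (hX' : ∀ r ∈ Ioo t s, HasDerivAt X (X' r) r ∧ 0 < X r - l r ∧
      1.999998 / (X r - l r) ≤ X' r ∧ X' r ≤ 2 / (X r - l r)) :
    CapturedPath (fun τ => (l s - l (s - δ * τ)) / √δ) (fun τ => (X s - X (s - δ * τ)) / √δ)
      (fun τ => √δ * X' (s - δ * τ)) ((X s - l s) / √δ) A := by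
  have hs : 0 < √δ := Real.sqrt_pos.2 hδ
  have hsq : √δ * √δ = δ := Real.mul_self_sqrt hδ.le
  have hmem : ∀ τ ∈ Ioo 0 A, s - δ * τ ∈ Ioo t s := by
    intro τ hτ
    constructor
    · nlinarith [hτ.2]
    · have := mul_pos hδ hτ.1
      linarith
  have hu : ∀ τ, (X s - l s) / √δ + (l s - l (s - δ * τ)) / √δ - (X s - X (s - δ * τ)) / √δ
      = (X (s - δ * τ) - l (s - δ * τ)) / √δ := by intro τ; ring
  refine ⟨by simp, ?_, ?_, ?_, ?_, ?_, ?_⟩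
  · refine (continuousOn_const.sub (hX.comp (by fun_prop) ?_)).div_const _
    intro τ hτ
    constructor
    · nlinarith [hτ.2]
    · have := mul_nonneg hδ.le hτ.1
      linarith
  · intro τ hτ
    have h1 := (hX' _ (hmem τ hτ)).1
    have h2 : HasDerivAt (fun τ => s - δ * τ) (-δ) τ := by
      simpa using ((hasDerivAt_id τ).const_mul δ).const_sub s
    refine (((h1.comp τ h2).const_sub (X s)).div_const (√δ)).congr_deriv ?_
    rw [div_eq_iff hs.ne']
    linear_combination X' (s - δ * τ) * (-hsq)
  · intro τ hτ
    rw [hu]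
    exact div_pos (hX' _ (hmem τ hτ)).2.1 hs
  · intro τ hτ
    rw [hu, div_div_eq_mul_div, mul_comm, mul_div_assoc]
    exact mul_le_mul_of_nonneg_left (hX' _ (hmem τ hτ)).2.2.1 hs.le
  · intro τ hτ
    rw [hu, div_div_eq_mul_div, mul_comm (2 : ℝ), mul_div_assoc]
    exact mul_le_mul_of_nonneg_left (hX' _ (hmem τ hτ)).2.2.2 hs.le
  · intro τ hτ
    have h := (le_abs_self _).trans (hl s (s - δ * τ))
    rw [show s - (s - δ * τ) = δ * τ by ring, abs_of_pos (mul_pos hδ hτ.1),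
      Real.sqrt_mul hδ.le] at h
    rw [div_le_iff₀ hs]
    linarith

theorem not_rightCapture_pair {l : ℝ → ℝ} (hl : SmallHolder l) {t S₁ S₂ : ℝ} (hS : S₁ < S₂)
    (hclose : 1500 * Real.exp 200000 * (S₂ - S₁) ≤ S₁ - t)
    (h₁ : RightCapture l t S₁) (h₂ : RightCapture l t S₂) : False := by
  set d := S₂ - S₁ with hd
  have hd0 : 0 < d := by linarith
  set κ : ℝ := 1e-6 * Real.exp (-100000) with hκ
  have hκ0 : 0 < κ := by positivity
  have hsd : 0 < √(d / 2) := Real.sqrt_pos.2 (by linarith)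
  obtain ⟨s₁, X₁, X₁', hs₁, c₁, hX₁, hn₁, he₁⟩ :=
    h₁ (min (d / 4) (κ * √(d / 2))) (lt_min (by linarith) (by positivity))
  obtain ⟨s₂, X₂, X₂', hs₂, c₂, hX₂, -, he₂⟩ :=
    h₂ (min (d / 4) (κ * √(d / 2))) (lt_min (by linarith) (by positivity))
  replace hs₁ := abs_lt.1 (hs₁.trans_le (min_le_left _ _))
  replace hs₂ := abs_lt.1 (hs₂.trans_le (min_le_left _ _))
  replace he₁ := he₁.trans (min_le_right _ _)
  replace he₂ := he₂.trans (min_le_right _ _)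
  set δ := s₂ - s₁ with hδ
  have hδ1 : d / 2 ≤ δ := by linarith [hs₁.2, hs₂.1]
  have hδ2 : δ ≤ 3 * d / 2 := by linarith [hs₁.1, hs₂.2]
  have hδ0 : 0 < δ := by linarith
  have hsδ : 0 < √δ := Real.sqrt_pos.2 hδ0
  have hE := Real.one_le_exp (show (0:ℝ) ≤ 200000 by norm_num)
  set E := Real.exp 200000 with hEdef
  -- The factor 1500 exceeds `712 * 3/2` by enough to absorb the error `d/4` in `s₁`.
  have hA : δ * (712 * E) ≤ s₁ - t := by nlinarith [hs₁.1]
  have hη : ∀ x, x ≤ κ * √(d / 2) → x / √δ ≤ κ := by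
    intro x hx
    rw [div_le_iff₀ hsδ]
    exact hx.trans (mul_le_mul_of_nonneg_left (Real.sqrt_le_sqrt hδ1) hκ0.le)
  refine CapturedPath.false_of_pair (L := (l s₂ - l s₁) / √δ)
    (capturedPath_rescale hl hδ0 hA c₁ hX₁)
    (capturedPath_rescale hl hδ0 (hA.trans (by linarith)) c₂ hX₂) (by nlinarith)
    (hη _ he₁) (hη _ he₂) (by positivity) ?_ ?_
  · intro r _
    rw [show s₂ - δ * (1 + r) = s₁ - δ * r by rw [hδ]; ring]
    ring
  · rw [div_le_iff₀ hsδ]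
    have := (le_abs_self _).trans (hl s₂ s₁)
    rwa [abs_of_pos (show 0 < s₂ - s₁ from hδ0)] at this

theorem exists_close_pair {𝒮 : Set ℝ} {a b d : ℝ} (h𝒮 : 𝒮.Infinite) (hsub : 𝒮 ⊆ Icc a b)
    (hd : 0 < d) : ∃ x ∈ 𝒮, ∃ y ∈ 𝒮, x < y ∧ y - x < d := by
  have hmaps : MapsTo (fun x : ℝ => ⌊x / d⌋) 𝒮 (Icc ⌊a / d⌋ ⌊b / d⌋) := by
    intro x hx
    have := hsub hx
    exact ⟨Int.floor_le_floor (div_le_div_of_nonneg_right this.1 hd.le),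
      Int.floor_le_floor (div_le_div_of_nonneg_right this.2 hd.le)⟩
  obtain ⟨x, hx, y, hy, hxy, h⟩ :=
    h𝒮.exists_ne_map_eq_of_mapsTo hmaps (finite_Icc _ _)
  have hab := Int.abs_sub_lt_one_of_floor_eq_floor h
  rw [← sub_div, abs_div, abs_of_pos hd, div_lt_one hd, abs_lt] at hab
  rcases lt_or_gt_of_ne hxy with h | h
  · exact ⟨x, hx, y, hy, h, by linarith [hab.1]⟩
  · exact ⟨y, hy, x, hx, h, by linarith [hab.2]⟩

/-- Among times at least `1/(n+1)` after `t`, two cannot be closer than a fixed fraction of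
`1/(n+1)`, so each such piece is finite. -/
theorem countable_of_rightCapture {l : ℝ → ℝ} (hl : SmallHolder l) {t T : ℝ} {𝒮 : Set ℝ}
    (hsub : 𝒮 ⊆ Ioc t T) (hcap : ∀ S ∈ 𝒮, RightCapture l t S) : 𝒮.Countable := by
  have hcover : 𝒮 ⊆ ⋃ n : ℕ, 𝒮 ∩ Icc (t + 1 / (n + 1)) T := by
    intro S hS
    obtain ⟨n, hn⟩ := exists_nat_one_div_lt (show 0 < S - t by linarith [(hsub hS).1])
    exact mem_iUnion.2 ⟨n, hS, by linarith, (hsub hS).2⟩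
  refine (countable_iUnion fun n => Set.Finite.countable ?_).mono hcover
  by_contra hinf
  have hn : (0 : ℝ) < 1 / ((n : ℝ) + 1) := Nat.one_div_pos_of_nat
  obtain ⟨x, hx, y, hy, hxy, h⟩ := exists_close_pair hinf inter_subset_right
    (show 0 < 1 / ((n : ℝ) + 1) / (1500 * Real.exp 200000) by positivity)
  refine not_rightCapture_pair hl hxy ?_ (hcap x hx.1) (hcap y hy.1)
  rw [lt_div_iff₀ (by positivity)] at h
  have := hx.2.1
  linarith

theorem countable_of_capture {l : ℝ → ℝ} (hl : SmallHolder l) {t T : ℝ} {𝒮 : Set ℝ}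
    (hsub : 𝒮 ⊆ Ioc t T)
    (hcap : ∀ S ∈ 𝒮, RightCapture l t S ∨ RightCapture (fun s => -l s) t S) : 𝒮.Countable := by
  have h1 := countable_of_rightCapture hl (𝒮 := {S ∈ 𝒮 | RightCapture l t S}) (T := T)
    (fun S hS => hsub hS.1) (fun S hS => hS.2)
  have h2 := countable_of_rightCapture hl.neg
    (𝒮 := {S ∈ 𝒮 | RightCapture (fun s => -l s) t S}) (T := T)
    (fun S hS => hsub hS.1) (fun S hS => hS.2)
  refine (h1.union h2).mono fun S hS => ?_
  rcases hcap S hS with h | h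
  · exact Or.inl ⟨hS, h⟩
  · exact Or.inr ⟨hS, h⟩

/-! ### Hyperbolic geometry of the upper half-plane -/

/-- The conformal map of the unit disc onto the upper half-plane that sends `0` to `p`. -/
noncomputable def cayleyMap (p ξ : ℂ) : ℂ := (p - conj p * ξ) / (1 - ξ)

/-- A conformally invariant measure of the distance of two points of the upper half-plane. -/
noncomputable def hypRatio (z w : ℂ) : ℝ := ‖z - w‖ ^ 2 / (z.im * w.im)

theorem norm_sub_conj_sq (z w : ℂ) : ‖z - conj w‖ ^ 2 = ‖z - w‖ ^ 2 + 4 * (z.im * w.im) := by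
  rw [Complex.sq_norm, Complex.sq_norm, Complex.normSq_apply, Complex.normSq_apply]
  simp
  ring

theorem sub_conj_ne_zero {z w : ℂ} (hz : 0 < z.im) (hw : 0 < w.im) : z - conj w ≠ 0 := by
  intro h
  have := congrArg Complex.im h
  simp at this
  linarith

theorem one_sub_ne_zero_of_norm_lt {ξ : ℂ} (hξ : ‖ξ‖ < 1) : 1 - ξ ≠ 0 := by
  intro h
  rw [← sub_eq_zero.1 h] at hξ
  simp at hξ

theorem cayleyMap_zero (p : ℂ) : cayleyMap p 0 = p := by simp [cayleyMap]

theorem cayleyMap_im (p ξ : ℂ) :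
    (cayleyMap p ξ).im = p.im * (1 - ‖ξ‖ ^ 2) / ‖1 - ξ‖ ^ 2 := by
  rw [cayleyMap, Complex.div_im, Complex.sq_norm, Complex.sq_norm, Complex.normSq_apply ξ]
  simp
  ring

theorem cayleyMap_im_pos {p ξ : ℂ} (hp : 0 < p.im) (hξ : ‖ξ‖ < 1) : 0 < (cayleyMap p ξ).im := by
  rw [cayleyMap_im]
  have h1 : 0 < ‖1 - ξ‖ := norm_pos_iff.2 (one_sub_ne_zero_of_norm_lt hξ)
  have h2 : 0 < 1 - ‖ξ‖ ^ 2 := by nlinarith [norm_nonneg ξ]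
  positivity

theorem differentiableOn_cayleyMap (p : ℂ) : DifferentiableOn ℂ (cayleyMap p) (Metric.ball 0 1) := by
  unfold cayleyMap
  refine DifferentiableOn.div (by fun_prop) (by fun_prop) ?_
  intro ξ hξ
  exact one_sub_ne_zero_of_norm_lt (mem_ball_zero_iff.1 hξ)

theorem hypRatio_cayleyMap_half {p : ℂ} (hp : 0 < p.im) : hypRatio (cayleyMap p (1 / 2)) p = 4 / 3 := by
  have h : cayleyMap p (1 / 2) = p + 2 * p.im * Complex.I := by
    unfold cayleyMap
    have h2 := Complex.sub_conj p
    push_cast at h2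
    have h3 : (1 - 1 / 2 : ℂ) ≠ 0 := by norm_num
    rw [div_eq_iff h3]
    linear_combination (1 / 2) * h2
  rw [hypRatio, h, add_sub_cancel_left, Complex.sq_norm, Complex.normSq_apply]
  simp
  field_simp
  norm_num

/-- The Schwarz lemma for `H` followed by the Cayley transform that sends `H 0` to the origin. -/
theorem norm_mul_le_of_mapsTo_upperHP {H : ℂ → ℂ} {ρ : ℝ}
    (hH : DifferentiableOn ℂ H (Metric.ball 0 ρ)) (hmaps : ∀ ξ, ‖ξ‖ < ρ → 0 < (H ξ).im)
    {ξ : ℂ} (hξ : ‖ξ‖ < ρ) : ‖H ξ - H 0‖ * ρ ≤ ‖ξ‖ * ‖H ξ - conj (H 0)‖ := by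
  have hρ : 0 < ρ := (norm_nonneg _).trans_lt hξ
  have h0 : 0 < (H 0).im := hmaps 0 (by simpa)
  have hd : DifferentiableOn ℂ (fun ξ => (H ξ - H 0) / (H ξ - conj (H 0))) (Metric.ball 0 ρ) := by
    refine DifferentiableOn.div (by fun_prop) (by fun_prop) ?_
    intro ζ hζ
    exact sub_conj_ne_zero (hmaps ζ (mem_ball_zero_iff.1 hζ)) h0
  have := Complex.dist_le_div_mul_dist_of_mapsTo_ball (R₂ := 1) hd ?_ (mem_ball_zero_iff.2 hξ)
  · simp only [sub_self, zero_div, dist_zero_right, norm_div] at this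
    have h1 : 0 < ‖H ξ - conj (H 0)‖ := norm_pos_iff.2 (sub_conj_ne_zero (hmaps ξ hξ) h0)
    rw [div_le_iff₀ h1] at this
    calc ‖H ξ - H 0‖ * ρ ≤ (1 / ρ * ‖ξ‖ * ‖H ξ - conj (H 0)‖) * ρ := by gcongr
      _ = _ := by field_simp
  · intro ζ hζ
    have h1 : 0 < (H ζ).im := hmaps ζ (mem_ball_zero_iff.1 hζ)
    simp only [sub_self, zero_div, Metric.mem_closedBall, dist_zero_right, norm_div]
    refine div_le_one_of_le₀ ?_ (norm_nonneg _)
    refine le_of_sq_le_sq ?_ (norm_nonneg _)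
    rw [norm_sub_conj_sq]
    have := mul_pos h1 h0
    linarith

theorem hypRatio_mul_le {H : ℂ → ℂ} {ρ : ℝ} (hρ : 1 / 2 < ρ)
    (hH : DifferentiableOn ℂ H (Metric.ball 0 ρ)) (hmaps : ∀ ξ, ‖ξ‖ < ρ → 0 < (H ξ).im) :
    hypRatio (H (1 / 2)) (H 0) * (ρ ^ 2 - 1 / 4) ≤ 1 := by
  have hn : ‖(1 / 2 : ℂ)‖ = 1 / 2 := by norm_num
  have h := norm_mul_le_of_mapsTo_upperHP hH hmaps (ξ := 1 / 2) (by rwa [hn])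
  have h1 := hmaps (1 / 2) (by rwa [hn])
  have h0 := hmaps 0 (by rw [norm_zero]; linarith)
  rw [hn] at h
  have hsq := pow_le_pow_left₀ (by positivity) h 2
  rw [mul_pow, mul_pow, norm_sub_conj_sq] at hsq
  rw [hypRatio, div_mul_eq_mul_div, div_le_one (by positivity)]
  linarith

/-- A primitive of `f'/f`, normalized at the origin. -/
theorem exists_log_of_ball {f : ℂ → ℂ} (hf : DifferentiableOn ℂ f (Metric.ball 0 1))
    (hf0 : ∀ z ∈ Metric.ball (0 : ℂ) 1, f z ≠ 0) :
    ∃ L : ℂ → ℂ, DifferentiableOn ℂ L (Metric.ball 0 1) ∧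
      ∀ z ∈ Metric.ball (0 : ℂ) 1, Complex.exp (L z) = f z := by
  have hmem : (0 : ℂ) ∈ Metric.ball (0 : ℂ) 1 := by simp
  have hd : DifferentiableOn ℂ (fun z => deriv f z / f z) (Metric.ball 0 1) :=
    (hf.deriv Metric.isOpen_ball).div hf hf0
  obtain ⟨L, hL0, hL⟩ := hd.isExactOn_ball.with_val_at 0 (Complex.log (f 0))
  refine ⟨L, fun z hz => (hL z hz).differentiableAt.differentiableWithinAt, ?_⟩
  have hder : ∀ z ∈ Metric.ball (0 : ℂ) 1,
      HasDerivAt (fun z => Complex.exp (-L z) * f z) 0 z := by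
    intro z hz
    have h1 := (hL z hz).neg.cexp
    have h2 := (hf.differentiableAt (Metric.isOpen_ball.mem_nhds hz)).hasDerivAt
    refine (h1.mul h2).congr_deriv ?_
    have := hf0 z hz
    field_simp
    simp
  have hconst : ∀ z ∈ Metric.ball (0 : ℂ) 1,
      Complex.exp (-L z) * f z = Complex.exp (-L 0) * f 0 := by
    intro z hz
    refine (convex_ball (0 : ℂ) 1).is_const_of_fderivWithin_eq_zero (𝕜 := ℂ)
      (f := fun z => Complex.exp (-L z) * f z)
      (fun w hw => (hder w hw).differentiableAt.differentiableWithinAt) ?_ hz hmem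
    intro w hw
    rw [fderivWithin_of_isOpen Metric.isOpen_ball hw]
    ext
    simpa using (hder w hw).deriv
  intro z hz
  have h1 := hconst z hz
  rw [hL0, Complex.exp_neg, Complex.exp_neg, Complex.exp_log (hf0 0 hmem),
    inv_mul_cancel₀ (hf0 0 hmem), inv_mul_eq_one₀ (Complex.exp_ne_zero _)] at h1
  exact h1

/-- **Harnack inequality** on the unit disc, for the real part of a holomorphic function. -/
theorem re_ge_of_re_pos {L : ℂ → ℂ} (hL : DifferentiableOn ℂ L (Metric.ball 0 1))
    (hpos : ∀ ξ, ‖ξ‖ < 1 → 0 < (L ξ).re) {ρ : ℝ} (hρ : ρ < 1) {ξ : ℂ} (hξ : ‖ξ‖ ≤ ρ) :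
    (1 - ρ ^ 2) / 4 * (L 0).re ≤ (L ξ).re := by
  have h := norm_mul_le_of_mapsTo_upperHP (H := fun ξ => Complex.I * L ξ) (ρ := 1) (ξ := ξ)
    (by fun_prop) (fun ζ hζ => by simpa using hpos ζ hζ) (by linarith)
  have h0 := hpos 0 (by simp)
  have h1 := hpos ξ (by linarith)
  rw [mul_one] at h
  have hsq := pow_le_pow_left₀ (by positivity) h 2
  rw [mul_pow, norm_sub_conj_sq] at hsq
  have e := norm_sub_conj_sq (Complex.I * L ξ) (Complex.I * L 0)
  have hge : (L 0).re ≤ ‖Complex.I * L ξ - conj (Complex.I * L 0)‖ := by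
    refine le_trans ?_ (Complex.abs_im_le_norm _)
    refine le_trans ?_ (le_abs_self _)
    simp
    linarith
  have hge2 := pow_le_pow_left₀ h0.le hge 2
  have hξ2 := pow_le_pow_left₀ (norm_nonneg ξ) hξ 2
  simp only [Complex.mul_im, Complex.I_re, Complex.I_im, zero_mul, one_mul, zero_add] at hsq e
  have h3 : (1 - ρ ^ 2) * (L 0).re ^ 2 ≤ 4 * ((L ξ).re * (L 0).re) := by
    have h5 : 0 ≤ 1 - ρ ^ 2 := by nlinarith [norm_nonneg ξ]
    nlinarith [mul_le_mul_of_nonneg_left hge2 h5, mul_le_mul_of_nonneg_right hξ2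
      (sq_nonneg ‖Complex.I * L ξ - conj (Complex.I * L 0)‖)]
  have h4 : ((1 - ρ ^ 2) * (L 0).re) * (L 0).re ≤ (4 * (L ξ).re) * (L 0).re := by linarith
  have := le_of_mul_le_mul_right h4 h0
  linarith

/-- A holomorphic map of the disc to the upper half-plane that omits `q` and is very close to `q`
at the origin is close to `q` on a given compact disc. -/
theorem exists_dist_lt_of_omits {q : ℂ} (hq : 0 < q.im) {ρ r : ℝ} (hρ0 : 0 < ρ) (hρ : ρ < 1)
    (hr : 0 < r) : ∃ d > 0, ∀ f : ℂ → ℂ, DifferentiableOn ℂ f (Metric.ball 0 1) →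
      (∀ ξ, ‖ξ‖ < 1 → 0 < (f ξ).im) → (∀ ξ, ‖ξ‖ < 1 → f ξ ≠ q) → ‖f 0 - q‖ < d →
      ∀ ξ, ‖ξ‖ ≤ ρ → ‖f ξ - q‖ < r := by
  set c := (1 - ρ ^ 2) / 4 with hc
  have hc0 : 0 < c := by
    have : 0 < 1 - ρ ^ 2 := by nlinarith
    positivity
  set M := Real.exp (Real.log (1 + 2 * q.im / r) / c) with hM
  have hM0 : 0 < M := Real.exp_pos _
  refine ⟨q.im / (M + 1), by positivity, ?_⟩
  intro f hf hfim hfq hf0 ξ hξ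
  by_contra hcon
  push Not at hcon
  have hmemball : ∀ z ∈ Metric.ball (0 : ℂ) 1, ‖z‖ < 1 := fun z hz => mem_ball_zero_iff.1 hz
  -- Omitting `q` makes this logarithm available. Its real part is positive and is large exactly
  -- when `f` is close to `q`, so Harnack carries closeness from the origin to the disc of radius
  -- `ρ`.
  obtain ⟨L, hL, hexp⟩ := exists_log_of_ball (f := fun ξ => (f ξ - conj q) / (f ξ - q))
    (DifferentiableOn.div (by fun_prop) (by fun_prop)
      (fun z hz => sub_ne_zero.2 (hfq z (hmemball z hz))))
    (fun z hz => div_ne_zero (sub_conj_ne_zero (hfim z (hmemball z hz)) hq)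
      (sub_ne_zero.2 (hfq z (hmemball z hz))))
  have hre : ∀ z, ‖z‖ < 1 → Real.exp (L z).re = ‖f z - conj q‖ / ‖f z - q‖ := by
    intro z hz
    rw [← Complex.norm_exp, hexp z (mem_ball_zero_iff.2 hz), norm_div]
  have hn : ∀ z, ‖z‖ < 1 → 0 < ‖f z - q‖ := fun z hz => norm_pos_iff.2 (sub_ne_zero.2 (hfq z hz))
  have hpos : ∀ z, ‖z‖ < 1 → 0 < (L z).re := by
    intro z hz
    rw [← Real.one_lt_exp_iff, hre z hz, one_lt_div (hn z hz)]
    refine lt_of_pow_lt_pow_left₀ 2 (norm_nonneg _) ?_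
    rw [norm_sub_conj_sq]
    have := mul_pos (hfim z hz) hq
    linarith
  have hξ1 : ‖ξ‖ < 1 := hξ.trans_lt hρ
  have hhar := re_ge_of_re_pos hL hpos hρ hξ
  rw [← hc] at hhar
  have hconj : ‖q - conj q‖ = 2 * q.im := by
    rw [Complex.sub_conj]
    simp [abs_of_pos hq]
  have hup : Real.exp (L ξ).re ≤ 1 + 2 * q.im / r := by
    rw [hre ξ hξ1, div_le_iff₀ (hn ξ hξ1)]
    have h1 : ‖f ξ - conj q‖ ≤ ‖f ξ - q‖ + 2 * q.im := by
      rw [← hconj]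
      simpa using norm_add_le (f ξ - q) (q - conj q)
    have h2 : 2 * q.im ≤ 2 * q.im / r * ‖f ξ - q‖ := by
      rw [div_mul_eq_mul_div, le_div_iff₀ hr]
      gcongr
    linarith
  have hlog : (L 0).re ≤ Real.log (1 + 2 * q.im / r) / c := by
    rw [le_div_iff₀ hc0]
    have := Real.log_le_log (Real.exp_pos _) hup
    rw [Real.log_exp] at this
    linarith
  have hlow : M < Real.exp (L 0).re := by
    rw [hre 0 (by simp), lt_div_iff₀ (hn 0 (by simp))]
    rw [lt_div_iff₀ (by positivity)] at hf0
    have h1 : 2 * q.im ≤ ‖f 0 - q‖ + ‖f 0 - conj q‖ := by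
      rw [← hconj, norm_sub_rev (f 0) q]
      simpa using norm_add_le (q - f 0) (f 0 - conj q)
    have h3 := hn 0 (by simp)
    nlinarith
  have := Real.exp_le_exp.2 hlog
  linarith

/-! ### The Loewner flow in the upper half-plane -/

/-- `g` solves the Loewner equation driven by `l` on the time interval `[a, b]`, with values in
the upper half-plane. -/
structure LoewnerFlow (l : ℝ → ℝ) (a b : ℝ) (g : ℝ → ℂ) : Prop where
  deriv : ∀ s ∈ Icc a b, HasDerivWithinAt g (2 / (g s - (l s : ℂ))) (Icc a b) s
  im_pos : ∀ s ∈ Icc a b, 0 < (g s).im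

theorem im_le_norm_sub_ofReal (z : ℂ) (x : ℝ) : z.im ≤ ‖z - x‖ := by
  have := Complex.abs_im_le_norm (z - x)
  simp at this
  exact (le_abs_self _).trans this

theorem sub_ofReal_ne_zero {z : ℂ} (hz : 0 < z.im) (x : ℝ) : z - x ≠ 0 :=
  norm_pos_iff.1 (hz.trans_le (im_le_norm_sub_ofReal z x))

theorem two_div_sub_ofReal_re (z : ℂ) (x : ℝ) :
    (2 / (z - (x : ℂ))).re = 2 * (z.re - x) / ((z.re - x) ^ 2 + z.im ^ 2) := by
  rw [Complex.div_re, Complex.normSq_apply]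
  simp
  ring

theorem two_div_sub_ofReal_im (z : ℂ) (x : ℝ) :
    (2 / (z - (x : ℂ))).im = -(2 * z.im) / ((z.re - x) ^ 2 + z.im ^ 2) := by
  rw [Complex.div_im, Complex.normSq_apply]
  simp
  ring

namespace LoewnerFlow

variable {l : ℝ → ℝ} {a b : ℝ} {g g₁ g₂ : ℝ → ℂ}

theorem mono (h : LoewnerFlow l a b g) {c d : ℝ} (hc : a ≤ c) (hd : d ≤ b) :
    LoewnerFlow l c d g :=
  ⟨fun s hs => (h.deriv s (Icc_subset_Icc hc hd hs)).mono (Icc_subset_Icc hc hd),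
    fun s hs => h.im_pos s (Icc_subset_Icc hc hd hs)⟩

theorem continuousOn (h : LoewnerFlow l a b g) : ContinuousOn g (Icc a b) :=
  fun s hs => (h.deriv s hs).continuousWithinAt

theorem deriv_re (h : LoewnerFlow l a b g) {s : ℝ} (hs : s ∈ Icc a b) :
    HasDerivWithinAt (fun s => (g s).re)
      (2 * ((g s).re - l s) / (((g s).re - l s) ^ 2 + (g s).im ^ 2)) (Icc a b) s := by
  rw [← two_div_sub_ofReal_re]
  exact Complex.reCLM.hasFDerivAt.comp_hasDerivWithinAt s (h.deriv s hs)

theorem deriv_im (h : LoewnerFlow l a b g) {s : ℝ} (hs : s ∈ Icc a b) :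
    HasDerivWithinAt (fun s => (g s).im)
      (-(2 * (g s).im) / (((g s).re - l s) ^ 2 + (g s).im ^ 2)) (Icc a b) s := by
  rw [← two_div_sub_ofReal_im]
  exact Complex.imCLM.hasFDerivAt.comp_hasDerivWithinAt s (h.deriv s hs)

theorem im_antitoneOn (h : LoewnerFlow l a b g) : AntitoneOn (fun s => (g s).im) (Icc a b) := by
  refine antitoneOn_of_hasDerivWithinAt_nonpos (convex_Icc a b)
    (fun s hs => (h.deriv_im hs).continuousWithinAt)
    (fun s hs => (h.deriv_im (interior_subset hs)).mono interior_subset) ?_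
  intro s hs
  have := h.im_pos s (interior_subset hs)
  rw [neg_div]
  have : 0 ≤ 2 * (g s).im / (((g s).re - l s) ^ 2 + (g s).im ^ 2) := by positivity
  linarith

theorem im_le_norm (h : LoewnerFlow l a b g) {s : ℝ} (hs : s ∈ Icc a b) :
    (g b).im ≤ ‖g s - l s‖ :=
  (h.im_antitoneOn hs (right_mem_Icc.2 (hs.1.trans hs.2)) hs.2).trans (im_le_norm_sub_ofReal _ _)

theorem continuousOn_kernel (hl : Continuous l) (h₁ : LoewnerFlow l a b g₁)
    (h₂ : LoewnerFlow l a b g₂) :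
    ContinuousOn (fun s => 2 / ((g₁ s - l s) * (g₂ s - l s))) (Icc a b) := by
  have c1 := h₁.continuousOn
  have c2 := h₂.continuousOn
  refine ContinuousOn.div continuousOn_const (by fun_prop) ?_
  intro s hs
  exact mul_ne_zero (sub_ofReal_ne_zero (h₁.im_pos s hs) _) (sub_ofReal_ne_zero (h₂.im_pos s hs) _)

/-- The difference of two trajectories satisfies a linear equation, which can be integrated. -/
theorem sub_mul_exp (hl : Continuous l) (hab : a ≤ b) (h₁ : LoewnerFlow l a b g₁)
    (h₂ : LoewnerFlow l a b g₂) :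
    g₁ a - g₂ a = (g₁ b - g₂ b) *
      Complex.exp (∫ s in a..b, 2 / ((g₁ s - l s) * (g₂ s - l s))) := by
  set k : ℝ → ℂ := fun s => 2 / ((g₁ s - l s) * (g₂ s - l s)) with hk
  set K : ℝ → ℂ := IccExtend hab ((Icc a b).domRestrict k) with hK
  have hKc : Continuous K :=
    (continuousOn_iff_continuous_domRestrict.1 (continuousOn_kernel hl h₁ h₂)).Icc_extend'
  have hKk : ∀ s ∈ Icc a b, K s = k s := by
    intro s hs
    simp only [hK, IccExtend_of_mem hab _ hs, domRestrict_apply]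
  have hint : ∫ s in a..b, k s = ∫ s in a..b, K s := by
    apply intervalIntegral.integral_congr
    intro s hs
    rw [uIcc_of_le hab] at hs
    exact (hKk s hs).symm
  have hder : ∀ s ∈ Icc a b, HasDerivWithinAt
      (fun s => (g₁ s - g₂ s) * Complex.exp (∫ r in a..s, K r)) 0 (Icc a b) s := by
    intro s hs
    have e1 := (h₁.deriv s hs).sub (h₂.deriv s hs)
    have e2 := (hKc.integral_hasStrictDerivAt a s).hasDerivAt.hasDerivWithinAt (s := Icc a b)
    refine (e1.mul e2.cexp).congr_deriv ?_
    have n1 := sub_ofReal_ne_zero (h₁.im_pos s hs) (l s)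
    have n2 := sub_ofReal_ne_zero (h₂.im_pos s hs) (l s)
    rw [hKk s hs]
    simp only [hk, Pi.sub_apply]
    field_simp
    ring
  have := constant_of_has_deriv_right_zero (fun s hs => (hder s hs).continuousWithinAt)
    (fun s hs => ((hder s (Ico_subset_Icc_self hs)).mono_of_mem_nhdsWithin
      (Icc_mem_nhdsGE_of_mem hs))) b (right_mem_Icc.2 hab)
  simp only [intervalIntegral.integral_same, Complex.exp_zero, mul_one] at this
  rw [hint, this]

theorem norm_kernel_le (h₁ : LoewnerFlow l a b g₁)
    (h₂ : LoewnerFlow l a b g₂) {s : ℝ} (hs : s ∈ Icc a b) :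
    ‖2 / ((g₁ s - l s) * (g₂ s - l s))‖ ≤ 2 / ((g₁ b).im * (g₂ b).im) := by
  have hb : b ∈ Icc a b := right_mem_Icc.2 (hs.1.trans hs.2)
  have n1 := h₁.im_le_norm hs
  have n2 := h₂.im_le_norm hs
  have p1 := h₁.im_pos b hb
  have p2 := h₂.im_pos b hb
  rw [norm_div, norm_mul, Complex.norm_two]
  gcongr

theorem norm_sub_le (hl : Continuous l) (h₁ : LoewnerFlow l a b g₁)
    (h₂ : LoewnerFlow l a b g₂) {s : ℝ} (hs : s ∈ Icc a b) :
    ‖g₁ s - g₂ s‖ ≤ ‖g₁ b - g₂ b‖ * Real.exp (2 / ((g₁ b).im * (g₂ b).im) * (b - a)) := by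
  have hb : b ∈ Icc a b := right_mem_Icc.2 (hs.1.trans hs.2)
  rw [(sub_mul_exp hl hs.2 (h₁.mono hs.1 le_rfl) (h₂.mono hs.1 le_rfl)), norm_mul,
    Complex.norm_exp]
  gcongr
  refine (Complex.re_le_norm _).trans ?_
  refine (intervalIntegral.norm_integral_le_of_norm_le_const
    (C := 2 / ((g₁ b).im * (g₂ b).im)) ?_).trans ?_
  · intro r hr
    rw [uIoc_of_le hs.2] at hr
    exact norm_kernel_le h₁ h₂ ⟨hs.1.trans hr.1.le, hr.2⟩
  · have p1 := h₁.im_pos b hb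
    have p2 := h₂.im_pos b hb
    rw [abs_of_nonneg (by linarith [hs.2])]
    gcongr
    exact hs.1

theorem eq_of_eq_right (hl : Continuous l) (h₁ : LoewnerFlow l a b g₁)
    (h₂ : LoewnerFlow l a b g₂) (h : g₁ b = g₂ b) {s : ℝ} (hs : s ∈ Icc a b) : g₁ s = g₂ s := by
  have := norm_sub_le hl h₁ h₂ hs
  rw [h, sub_self, norm_zero, zero_mul] at this
  exact sub_eq_zero.1 (norm_eq_zero.1 (le_antisymm this (norm_nonneg _)))

theorem eq_of_eq_left (hl : Continuous l) (h₁ : LoewnerFlow l a b g₁)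
    (h₂ : LoewnerFlow l a b g₂) (h : g₁ a = g₂ a) {s : ℝ} (hs : s ∈ Icc a b) : g₁ s = g₂ s := by
  have := sub_mul_exp hl hs.1 (h₁.mono le_rfl hs.2) (h₂.mono le_rfl hs.2)
  rw [h, sub_self] at this
  rcases mul_eq_zero.1 this.symm with h | h
  · exact sub_eq_zero.1 h
  · exact absurd h (Complex.exp_ne_zero _)

/-- The Loewner flow expands the hyperbolic metric. -/
theorem hypRatio_mul_le {c : ℝ} (hab : a ≤ b) (h₁ : LoewnerFlow l a b g₁)
    (h₂ : LoewnerFlow l a b g₂)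
    (hc : ∀ s ∈ Icc a b, c ≤ 2 * ((g₁ s).im / (((g₁ s).re - l s) ^ 2 + (g₁ s).im ^ 2)) ^ 2) :
    hypRatio (g₁ a) (g₂ a) * (1 + c * (b - a)) ≤ hypRatio (g₁ b) (g₂ b) := by
  have hφ : ∀ s, hypRatio (g₁ s) (g₂ s) =
      (((g₁ s).re - (g₂ s).re) ^ 2 + ((g₁ s).im - (g₂ s).im) ^ 2) / ((g₁ s).im * (g₂ s).im) := by
    intro s
    rw [hypRatio, Complex.sq_norm, Complex.normSq_apply, Complex.sub_re, Complex.sub_im]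
    ring
  have hnn : ∀ s ∈ Icc a b, 0 ≤ hypRatio (g₁ s) (g₂ s) := by
    intro s hs
    have p1 := h₁.im_pos s hs
    have p2 := h₂.im_pos s hs
    rw [hypRatio]
    positivity
  set n₁ : ℝ → ℝ := fun s => ((g₁ s).re - l s) ^ 2 + (g₁ s).im ^ 2 with hn₁
  set n₂ : ℝ → ℝ := fun s => ((g₂ s).re - l s) ^ 2 + (g₂ s).im ^ 2 with hn₂
  -- This is `2 |1/(g₁ - l) - conj (1/(g₂ - l))|²`, the exact logarithmic derivative of `hypRatio`
  -- along the flow.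
  set R : ℝ → ℝ := fun s => 2 * ((((g₁ s).re - l s) / n₁ s - ((g₂ s).re - l s) / n₂ s) ^ 2 +
    ((g₁ s).im / n₁ s + (g₂ s).im / n₂ s) ^ 2) with hR
  have hR0 : ∀ s, 0 ≤ R s := fun s => by positivity
  have hder : ∀ s ∈ Icc a b, HasDerivWithinAt (fun s => hypRatio (g₁ s) (g₂ s))
      (hypRatio (g₁ s) (g₂ s) * R s) (Icc a b) s := by
    intro s hs
    have p1 := h₁.im_pos s hs
    have p2 := h₂.im_pos s hs
    have x1 := h₁.deriv_re hs
    have x2 := h₂.deriv_re hs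
    have y1 := h₁.deriv_im hs
    have y2 := h₂.deriv_im hs
    have D := (((x1.sub x2).pow 2).add ((y1.sub y2).pow 2)).div (y1.mul y2)
      (mul_pos p1 p2).ne'
    have hfun : (fun s => hypRatio (g₁ s) (g₂ s)) = fun s =>
      (((g₁ s).re - (g₂ s).re) ^ 2 + ((g₁ s).im - (g₂ s).im) ^ 2) / ((g₁ s).im * (g₂ s).im) :=
      funext hφ
    rw [hfun]
    refine D.congr_deriv ?_
    simp only [hR, hn₁, hn₂, hφ, Pi.sub_apply, Pi.mul_apply, Pi.add_apply, Pi.pow_apply]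
    set X₁ := (g₁ s).re - l s with hX₁
    set X₂ := (g₂ s).re - l s with hX₂
    have e : (g₁ s).re - (g₂ s).re = X₁ - X₂ := by rw [hX₁, hX₂]; ring
    rw [e]
    have q1 : X₁ ^ 2 + (g₁ s).im ^ 2 ≠ 0 := by positivity
    have q2 : X₂ ^ 2 + (g₂ s).im ^ 2 ≠ 0 := by positivity
    have q3 := p1.ne'
    have q4 := p2.ne'
    generalize (g₁ s).im = Y₁ at *
    generalize (g₂ s).im = Y₂ at *
    clear_value X₁ X₂
    field_simp
    ring
  have hmono : MonotoneOn (fun s => hypRatio (g₁ s) (g₂ s)) (Icc a b) := by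
    refine monotoneOn_of_hasDerivWithinAt_nonneg (convex_Icc a b)
      (fun s hs => (hder s hs).continuousWithinAt)
      (fun s hs => (hder s (interior_subset hs)).mono interior_subset) ?_
    intro s hs
    exact mul_nonneg (hnn s (interior_subset hs)) (hR0 s)
  have ha : a ∈ Icc a b := left_mem_Icc.2 hab
  have hb : b ∈ Icc a b := right_mem_Icc.2 hab
  have hmono' : MonotoneOn (fun s => hypRatio (g₁ s) (g₂ s) - hypRatio (g₁ a) (g₂ a) * c * s)
      (Icc a b) := by
    have hd : ∀ s ∈ Icc a b, HasDerivWithinAt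
        (fun s => hypRatio (g₁ s) (g₂ s) - hypRatio (g₁ a) (g₂ a) * c * s)
        (hypRatio (g₁ s) (g₂ s) * R s - hypRatio (g₁ a) (g₂ a) * c) (Icc a b) s := by
      intro s hs
      have := (hasDerivWithinAt_id s (Icc a b)).const_mul (hypRatio (g₁ a) (g₂ a) * c)
      rw [mul_one] at this
      exact (hder s hs).sub this
    refine monotoneOn_of_hasDerivWithinAt_nonneg (convex_Icc a b)
      (fun s hs => (hd s hs).continuousWithinAt)
      (fun s hs => (hd s (interior_subset hs)).mono interior_subset) ?_
    intro s hs
    have hs' := interior_subset hs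
    have p1 := h₁.im_pos s hs'
    have p2 := h₂.im_pos s hs'
    have hcR : c ≤ R s := by
      refine (hc s hs').trans ?_
      have t1 : 0 ≤ (g₁ s).im / n₁ s := by positivity
      have t2 : 0 ≤ (g₂ s).im / n₂ s := by positivity
      simp only [hR]
      have t3 := sq_nonneg (((g₁ s).re - l s) / n₁ s - ((g₂ s).re - l s) / n₂ s)
      change 2 * ((g₁ s).im / n₁ s) ^ 2 ≤ _
      nlinarith
    have := hmono ha hs' hs'.1
    have h3 : hypRatio (g₁ a) (g₂ a) * c ≤ hypRatio (g₁ a) (g₂ a) * R s :=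
      mul_le_mul_of_nonneg_left hcR (hnn a ha)
    have h4 : hypRatio (g₁ a) (g₂ a) * R s ≤ hypRatio (g₁ s) (g₂ s) * R s :=
      mul_le_mul_of_nonneg_right this (hR0 s)
    linarith
  have := hmono' ha hb hab
  simp only at this
  linarith

end LoewnerFlow

/-! ### Existence of the flow and holomorphic dependence on the starting point -/

/-- Raise the imaginary part of a complex number to at least `m`. -/
noncomputable def raiseIm (m : ℝ) (w : ℂ) : ℂ := ⟨w.re, max w.im m⟩

theorem norm_raiseIm_sub_le (m : ℝ) (w w' : ℂ) : ‖raiseIm m w - raiseIm m w'‖ ≤ ‖w - w'‖ := by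
  refine le_of_sq_le_sq ?_ (norm_nonneg _)
  rw [Complex.sq_norm, Complex.sq_norm, Complex.normSq_apply, Complex.normSq_apply]
  simp only [raiseIm, Complex.sub_re, Complex.sub_im]
  have := sq_le_sq.2 (abs_max_sub_max_le_abs w.im w'.im m)
  linarith

theorem raiseIm_of_le {m : ℝ} {w : ℂ} (h : m ≤ w.im) : raiseIm m w = w :=
  Complex.ext rfl (max_eq_left h)

theorem raiseIm_im_pos {m : ℝ} (hm : 0 < m) (w : ℂ) : 0 < (raiseIm m w).im :=
  hm.trans_le (le_max_right _ _)

theorem le_norm_raiseIm_sub (m : ℝ) (w : ℂ) (x : ℝ) : m ≤ ‖raiseIm m w - x‖ :=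
  (le_max_right _ _).trans (im_le_norm_sub_ofReal (raiseIm m w) x)

/-- Raising the imaginary part makes the vector field bounded and globally Lipschitz, so
Picard–Lindelöf covers the whole interval. Where the solution stays above height `m` it solves the
true equation. -/
theorem exists_raised_solution {l : ℝ → ℝ} (hl : Continuous l) {m : ℝ} (hm : 0 < m) {a b c : ℝ}
    (hab : a ≤ b) (hbc : b ≤ c) (w : ℂ) : ∃ g : ℝ → ℂ, g b = w ∧
      ∀ s ∈ Icc a c, HasDerivWithinAt g (2 / (raiseIm m (g s) - (l s : ℂ))) (Icc a c) s := by
  have hbnd : ∀ (s : ℝ) (x : ℂ), ‖2 / (raiseIm m x - (l s : ℂ))‖ ≤ 2 / m := by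
    intro s x
    rw [norm_div, Complex.norm_two]
    have := le_norm_raiseIm_sub m x (l s)
    gcongr
  have hP : IsPicardLindelof (fun s x => 2 / (raiseIm m x - (l s : ℂ)))
      (⟨b, hab, hbc⟩ : Icc a c) w (Real.toNNReal (2 / m * (c - a))) 0 (Real.toNNReal (2 / m))
      (Real.toNNReal (2 / m ^ 2)) := by
    refine ⟨?_, ?_, ?_, ?_⟩
    · intro s _
      refine (LipschitzWith.of_dist_le_mul fun x y => ?_).lipschitzOnWith
      rw [dist_eq_norm, dist_eq_norm, Real.coe_toNNReal _ (by positivity)]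
      have n1 := le_norm_raiseIm_sub m x (l s)
      have n2 := le_norm_raiseIm_sub m y (l s)
      have z1 := sub_ofReal_ne_zero (raiseIm_im_pos hm x) (l s)
      have z2 := sub_ofReal_ne_zero (raiseIm_im_pos hm y) (l s)
      have e : 2 / (raiseIm m x - (l s : ℂ)) - 2 / (raiseIm m y - (l s : ℂ)) =
          2 / ((raiseIm m x - (l s : ℂ)) * (raiseIm m y - (l s : ℂ))) *
            (raiseIm m y - raiseIm m x) := by
        field_simp
        ring
      rw [e, norm_mul, norm_div, norm_mul, Complex.norm_two, norm_sub_rev x y, sq]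
      have := norm_raiseIm_sub_le m y x
      gcongr
    · intro x _
      refine (Continuous.div continuous_const (by fun_prop) fun s => ?_).continuousOn
      exact sub_ofReal_ne_zero (raiseIm_im_pos hm x) (l s)
    · intro s _ x _
      rw [Real.coe_toNNReal _ (by positivity)]
      exact hbnd s x
    · rw [Real.coe_toNNReal _ (by positivity),
        Real.coe_toNNReal _ (mul_nonneg (by positivity) (by linarith))]
      simp only [NNReal.coe_zero, sub_zero]
      gcongr
      exact max_le (by linarith) (by linarith)
  exact hP.exists_eq_forall_mem_Icc_hasDerivWithinAt₀

/-- Through every point of the upper half-plane there is a solution of the Loewner equation that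
extends arbitrarily far into the past, and for a controlled time into the future. -/
theorem exists_loewnerFlow {l : ℝ → ℝ} (hl : Continuous l) {a b : ℝ} (hab : a ≤ b) {w : ℂ}
    (hw : 0 < w.im) : ∃ g, LoewnerFlow l a (b + w.im ^ 2 / 8) g ∧ g b = w := by
  set m := w.im / 2 with hm
  have hm0 : 0 < m := by positivity
  set c := b + w.im ^ 2 / 8 with hc
  have hbc : b ≤ c := by simp only [hc]; linarith [sq_nonneg w.im]
  obtain ⟨g, hgb, hg⟩ := exists_raised_solution hl hm0 hab hbc w
  have hbI : b ∈ Icc a c := ⟨hab, hbc⟩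
  have hanti : AntitoneOn (fun s => (g s).im) (Icc a c) := by
    have hd : ∀ s ∈ Icc a c, HasDerivWithinAt (fun s => (g s).im)
        (2 / (raiseIm m (g s) - (l s : ℂ))).im (Icc a c) s :=
      fun s hs => Complex.imCLM.hasFDerivAt.comp_hasDerivWithinAt s (hg s hs)
    refine antitoneOn_of_hasDerivWithinAt_nonpos (convex_Icc a c)
      (fun s hs => (hd s hs).continuousWithinAt)
      (fun s hs => (hd s (interior_subset hs)).mono interior_subset) ?_
    intro s _
    have := raiseIm_im_pos hm0 (g s)
    rw [two_div_sub_ofReal_im, neg_div]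
    have : 0 ≤ 2 * (raiseIm m (g s)).im /
      (((raiseIm m (g s)).re - l s) ^ 2 + (raiseIm m (g s)).im ^ 2) := by positivity
    linarith
  have him : ∀ s ∈ Icc a c, m ≤ (g s).im := by
    intro s hs
    rcases le_total s b with h | h
    · have := hanti hs hbI h
      simp only [hgb] at this
      linarith
    · have hle := Convex.norm_image_sub_le_of_norm_hasDerivWithin_le (C := 2 / m) hg
        (fun x hx => by
          rw [norm_div, Complex.norm_two]
          have := le_norm_raiseIm_sub m (g x) (l x)
          gcongr) (convex_Icc a c) hbI hs
      rw [hgb, Real.norm_of_nonneg (by linarith)] at hle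
      have h1 : 2 / m * (s - b) ≤ w.im / 2 := by
        have : s - b ≤ w.im ^ 2 / 8 := by linarith [hs.2]
        calc 2 / m * (s - b) ≤ 2 / m * (w.im ^ 2 / 8) := by gcongr
          _ = w.im / 2 := by rw [hm]; field_simp; norm_num
      have h2 := (Complex.abs_im_le_norm (g s - w)).trans (hle.trans h1)
      rw [Complex.sub_im, abs_le] at h2
      linarith [h2.1]
  refine ⟨g, ⟨fun s hs => ?_, fun s hs => hm0.trans_le (him s hs)⟩, hgb⟩
  have := hg s hs
  rwa [raiseIm_of_le (him s hs)] at this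

theorem exists_loewnerFlow_right {l : ℝ → ℝ} (hl : Continuous l) {a b : ℝ} (hab : a ≤ b) {w : ℂ}
    (hw : 0 < w.im) : ∃ g, LoewnerFlow l a b g ∧ g b = w := by
  obtain ⟨g, hg, hgb⟩ := exists_loewnerFlow hl hab hw
  exact ⟨g, hg.mono le_rfl (by linarith [sq_nonneg w.im]), hgb⟩

open Classical in
/-- The Loewner flow followed backwards from time `b` to time `a`. -/
noncomputable def backMap (l : ℝ → ℝ) (a b : ℝ) (w : ℂ) : ℂ :=
  if h : ∃ g, LoewnerFlow l a b g ∧ g b = w then h.choose a else w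

theorem LoewnerFlow.backMap_eq {l : ℝ → ℝ} (hl : Continuous l) {a b : ℝ} (hab : a ≤ b)
    {g : ℝ → ℂ} (hg : LoewnerFlow l a b g) : backMap l a b (g b) = g a := by
  have h : ∃ g', LoewnerFlow l a b g' ∧ g' b = g b := ⟨g, hg, rfl⟩
  rw [backMap, dif_pos h]
  exact h.choose_spec.1.eq_of_eq_right hl hg h.choose_spec.2 (left_mem_Icc.2 hab)

theorem backMap_im_pos {l : ℝ → ℝ} (hl : Continuous l) {a b : ℝ} (hab : a ≤ b) {w : ℂ}
    (hw : 0 < w.im) : 0 < (backMap l a b w).im := by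
  obtain ⟨g, hg, rfl⟩ := exists_loewnerFlow_right hl hab hw
  rw [hg.backMap_eq hl hab]
  exact hg.im_pos a (left_mem_Icc.2 hab)

/-- By `LoewnerFlow.sub_mul_exp` difference quotients are exponentials of integrals, which converge
as the two trajectories merge. The limit, being an exponential, is nonzero. -/
theorem exists_hasDerivAt_backMap {l : ℝ → ℝ} (hl : Continuous l) {a b : ℝ} (hab : a ≤ b) {w : ℂ}
    (hw : 0 < w.im) : ∃ c : ℂ, c ≠ 0 ∧ HasDerivAt (backMap l a b) c w := by
  choose! H hH hHb using fun (w : ℂ) (hw : 0 < w.im) => exists_loewnerFlow_right hl hab hw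
  set I : ℂ → ℂ := fun w' => ∫ s in a..b, 2 / ((H w' s - l s) * (H w s - l s)) with hI
  refine ⟨Complex.exp (I w), Complex.exp_ne_zero _, ?_⟩
  have hnear : ∀ᶠ w' : ℂ in nhds w, w.im / 2 < w'.im :=
    (Complex.continuous_im.tendsto w).eventually (lt_mem_nhds (by linarith))
  have hslope : ∀ᶠ w' in nhdsWithin w {w}ᶜ, Complex.exp (I w') = slope (backMap l a b) w w' := by
    filter_upwards [nhdsWithin_le_nhds hnear, self_mem_nhdsWithin] with w' hw' hne
    have hw'0 : 0 < w'.im := by linarith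
    have e := (hH w' hw'0).sub_mul_exp hl hab (hH w hw)
    have e1 := (hH w' hw'0).backMap_eq hl hab
    have e2 := (hH w hw).backMap_eq hl hab
    rw [hHb _ hw'0] at e1 e
    rw [hHb _ hw] at e2 e
    rw [slope_def_field, e1, e2, e, eq_div_iff (sub_ne_zero.2 hne)]
    ring
  rw [hasDerivAt_iff_tendsto_slope]
  refine Filter.Tendsto.congr' hslope ?_
  refine (Complex.continuous_exp.tendsto _).comp ?_
  refine Filter.Tendsto.mono_left ?_ nhdsWithin_le_nhds
  rw [tendsto_iff_norm_sub_tendsto_zero]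
  set y := w.im with hy
  set B := 2 * Real.exp (2 / (y / 2 * y) * (b - a)) / (y * y * (y / 2)) * (b - a) with hB
  refine squeeze_zero' (Filter.Eventually.of_forall fun _ => norm_nonneg _)
    (g := fun w' => B * ‖w' - w‖) ?_ ?_
  · filter_upwards [hnear] with w' hw'
    have hw'0 : 0 < w'.im := by linarith
    have c1 := (hH w' hw'0).continuousOn_kernel hl (hH w hw)
    have c2 := (hH w hw).continuousOn_kernel hl (hH w hw)
    rw [← uIcc_of_le hab] at c1 c2
    rw [hI, ← intervalIntegral.integral_sub c1.intervalIntegrable c2.intervalIntegrable]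
    refine (intervalIntegral.norm_integral_le_of_norm_le_const
      (C := 2 * Real.exp (2 / (y / 2 * y) * (b - a)) / (y * y * (y / 2)) * ‖w' - w‖) ?_).trans ?_
    · intro s hs
      rw [uIoc_of_le hab] at hs
      have hs' : s ∈ Icc a b := ⟨hs.1.le, hs.2⟩
      have n1 := (hH w' hw'0).im_le_norm hs'
      have n2 := (hH w hw).im_le_norm hs'
      have hd := (hH w' hw'0).norm_sub_le hl (hH w hw) hs'
      rw [hHb _ hw'0] at n1 hd
      rw [hHb _ hw] at n2 hd
      have z1 := sub_ofReal_ne_zero ((hH w' hw'0).im_pos s hs') (l s)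
      have z2 := sub_ofReal_ne_zero ((hH w hw).im_pos s hs') (l s)
      have e : 2 / ((H w' s - (l s : ℂ)) * (H w s - l s)) - 2 / ((H w s - l s) * (H w s - l s)) =
          2 * (H w s - H w' s) / ((H w s - l s) * (H w s - l s) * (H w' s - l s)) := by
        field_simp
        ring
      rw [e, norm_div, norm_mul, norm_mul, norm_mul, Complex.norm_two, norm_sub_rev]
      have hd' : ‖H w' s - H w s‖ ≤ ‖w' - w‖ * Real.exp (2 / (y / 2 * y) * (b - a)) := by
        refine hd.trans ?_
        have : 0 ≤ b - a := by linarith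
        gcongr
      calc 2 * ‖H w' s - H w s‖ / (‖H w s - l s‖ * ‖H w s - l s‖ * ‖H w' s - l s‖)
          ≤ 2 * (‖w' - w‖ * Real.exp (2 / (y / 2 * y) * (b - a))) / (y * y * (y / 2)) := by
            gcongr
            linarith
        _ = _ := by ring
    · rw [abs_of_nonneg (by linarith)]
      exact le_of_eq (by rw [hB]; ring)
  · have : Continuous fun w' : ℂ => B * ‖w' - w‖ := by fun_prop
    simpa using this.tendsto w

theorem differentiableOn_backMap {l : ℝ → ℝ} (hl : Continuous l) {a b : ℝ} (hab : a ≤ b) :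
    DifferentiableOn ℂ (backMap l a b) upperHP := by
  intro w hw
  obtain ⟨c, -, hc⟩ := exists_hasDerivAt_backMap hl hab hw
  exact hc.differentiableAt.differentiableWithinAt

theorem isOpen_upperHP : IsOpen upperHP := isOpen_lt continuous_const Complex.continuous_im

theorem map_nhds_backMap {l : ℝ → ℝ} (hl : Continuous l) {a b : ℝ} (hab : a ≤ b) {w : ℂ}
    (hw : 0 < w.im) : Filter.map (backMap l a b) (nhds w) = nhds (backMap l a b w) := by
  obtain ⟨c, hc0, hc⟩ := exists_hasDerivAt_backMap hl hab hw
  have han : AnalyticAt ℂ (backMap l a b) w :=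
    (differentiableOn_backMap hl hab).analyticAt (isOpen_upperHP.mem_nhds hw)
  have hs := han.hasStrictDerivAt
  rw [hc.deriv] at hs
  exact hs.map_nhds_eq hc0

/-- The forward Loewner flow is holomorphic on every open set of points that survive. -/
theorem differentiableOn_of_flows {l : ℝ → ℝ} (hl : Continuous l) {a b : ℝ} (hab : a ≤ b)
    {U : Set ℂ} (hU : IsOpen U) {G : ℂ → ℝ → ℂ}
    (hG : ∀ z ∈ U, LoewnerFlow l a b (G z) ∧ G z a = z) :
    DifferentiableOn ℂ (fun z => G z b) U := by
  intro z hz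
  have hb : b ∈ Icc a b := right_mem_Icc.2 hab
  have ha : a ∈ Icc a b := left_mem_Icc.2 hab
  have him : 0 < (G z b).im := (hG z hz).1.im_pos b hb
  have hleft : ∀ z ∈ U, backMap l a b (G z b) = z := fun z hz => by
    rw [(hG z hz).1.backMap_eq hl hab, (hG z hz).2]
  obtain ⟨c, hc0, hc⟩ := exists_hasDerivAt_backMap hl hab him
  -- `backMap` carries neighbourhoods onto neighbourhoods, and uniqueness of trajectories identifies
  -- the preimage so obtained with `G z' b`.
  have hcont : ContinuousAt (fun z => G z b) z := by
    intro V hV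
    have hV' : V ∩ upperHP ∈ nhds (G z b) := Filter.inter_mem hV (isOpen_upperHP.mem_nhds him)
    have := Filter.image_mem_map (m := backMap l a b) hV'
    rw [map_nhds_backMap hl hab him, hleft z hz] at this
    rw [Filter.mem_map]
    filter_upwards [this, hU.mem_nhds hz] with z' hz' hzU
    obtain ⟨w, ⟨hwV, hw0⟩, hwz⟩ := hz'
    obtain ⟨g, hg, rfl⟩ := exists_loewnerFlow_right hl hab hw0
    rw [hg.backMap_eq hl hab, ← (hG z' hzU).2] at hwz
    have := hg.eq_of_eq_left hl (hG z' hzU).1 hwz hb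
    change G z' b ∈ V
    rwa [← this]
  have := hc.of_local_left_inverse (g := fun z => G z b) hcont hc0
    (Filter.eventually_of_mem (hU.mem_nhds hz) hleft)
  exact this.differentiableAt.differentiableWithinAt

/-! ### Growth of hulls and swallowing times -/

namespace LoewnerFlow

variable {l : ℝ → ℝ} {a b : ℝ} {g : ℝ → ℂ}

theorem sq_im_ge (h : LoewnerFlow l a b g) {s : ℝ} (hs : s ∈ Icc a b) :
    (g a).im ^ 2 - 4 * (s - a) ≤ (g s).im ^ 2 := by
  have hmono : MonotoneOn (fun s => (g s).im ^ 2 + 4 * s) (Icc a b) := by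
    have hd : ∀ s ∈ Icc a b, HasDerivWithinAt (fun s => (g s).im ^ 2 + 4 * s)
        (2 * (g s).im * (-(2 * (g s).im) / (((g s).re - l s) ^ 2 + (g s).im ^ 2)) + 4)
        (Icc a b) s := by
      intro s hs
      have h1 := (h.deriv_im hs).pow 2
      have h2 := (hasDerivWithinAt_id s (Icc a b)).const_mul (4 : ℝ)
      rw [mul_one] at h2
      refine (h1.add h2).congr_deriv ?_
      simp
    refine monotoneOn_of_hasDerivWithinAt_nonneg (convex_Icc a b)
      (fun s hs => (hd s hs).continuousWithinAt)
      (fun s hs => (hd s (interior_subset hs)).mono interior_subset) ?_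
    intro s hs
    have hp := h.im_pos s (interior_subset hs)
    have hn : 0 < ((g s).re - l s) ^ 2 + (g s).im ^ 2 := by positivity
    have : 2 * (g s).im * (-(2 * (g s).im) / (((g s).re - l s) ^ 2 + (g s).im ^ 2)) + 4 =
        4 * ((g s).re - l s) ^ 2 / (((g s).re - l s) ^ 2 + (g s).im ^ 2) := by
      field_simp
      ring
    rw [this]
    positivity
  have := hmono (left_mem_Icc.2 (hs.1.trans hs.2)) hs hs.1
  simp only at this
  linarith

/-- During time `p.im ^ 2 / 16` the height stays above `0.8 * p.im`, the point moves by at most `0.2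
* p.im` and the driving function by about `p.im`, so the geometry at time `a` persists. -/
theorem expansion_rate_ge (hl : SmallHolder l) {p : ℂ} {K : ℝ} (hK : 0 ≤ K) (hp : 0 < p.im)
    (hKp : |p.re - l a| ≤ K * p.im) (h : LoewnerFlow l a (a + p.im ^ 2 / 16) g) (ha : g a = p)
    {s : ℝ} (hs : s ∈ Icc a (a + p.im ^ 2 / 16)) :
    1 / ((K + 3) ^ 4 * p.im ^ 2) ≤
      2 * ((g s).im / (((g s).re - l s) ^ 2 + (g s).im ^ 2)) ^ 2 := by
  set Y := p.im with hY
  have him : ∀ s ∈ Icc a (a + Y ^ 2 / 16), 0.8 * Y ≤ (g s).im := by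
    intro s hs
    have h1 := h.sq_im_ge hs
    rw [ha] at h1
    have h2 := h.im_pos s hs
    refine le_of_sq_le_sq ?_ h2.le
    nlinarith [hs.2]
  have haI : a ∈ Icc a (a + Y ^ 2 / 16) := left_mem_Icc.2 (by linarith [sq_nonneg Y])
  have hmove : ‖g s - p‖ ≤ 0.2 * Y := by
    have hle := Convex.norm_image_sub_le_of_norm_hasDerivWithin_le (C := 2 / (0.8 * Y)) h.deriv
      (fun x hx => by
        rw [norm_div, Complex.norm_two]
        have := (him x hx).trans (im_le_norm_sub_ofReal (g x) (l x))
        gcongr) (convex_Icc _ _) haI hs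
    rw [ha, Real.norm_of_nonneg (by linarith [hs.1])] at hle
    refine hle.trans ?_
    calc 2 / (0.8 * Y) * (s - a) ≤ 2 / (0.8 * Y) * (Y ^ 2 / 16) := by
          gcongr
          linarith [hs.2]
      _ = 0.15625 * Y := by field_simp; norm_num
      _ ≤ _ := by linarith
  have hlam : |l s - l a| ≤ 1.01 * Y := by
    refine (hl s a).trans ?_
    have : √|s - a| ≤ Y / 4 := by
      refine Real.sqrt_le_iff.2 ⟨by linarith, ?_⟩
      rw [abs_of_nonneg (by linarith [hs.1])]
      linarith [hs.2]
    linarith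
  have hre : |(g s).re - l s| ≤ (K + 1.3) * Y := by
    have h1 := (Complex.abs_re_le_norm (g s - p)).trans hmove
    rw [Complex.sub_re] at h1
    rw [abs_le] at *
    constructor <;> linarith [h1.1, h1.2, hlam.1, hlam.2, hKp.1, hKp.2]
  have him2 : (g s).im ≤ Y := by
    have := h.im_antitoneOn haI hs hs.1
    simpa [ha] using this
  have him1 := him s hs
  have hn : ((g s).re - l s) ^ 2 + (g s).im ^ 2 ≤ ((K + 3) * Y) ^ 2 := by
    have h1 := sq_le_sq' (by linarith [(abs_le.1 hre).1]) (abs_le.1 hre).2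
    have h2 : (g s).im ^ 2 ≤ Y ^ 2 := pow_le_pow_left₀ (by linarith) him2 2
    nlinarith [mul_nonneg hK (sq_nonneg Y), sq_nonneg Y]
  have hpos := h.im_pos s hs
  have hq : 0.8 * Y / ((K + 3) * Y) ^ 2 ≤ (g s).im / (((g s).re - l s) ^ 2 + (g s).im ^ 2) := by
    gcongr
  calc 1 / ((K + 3) ^ 4 * Y ^ 2) ≤ 2 * (0.8 * Y / ((K + 3) * Y) ^ 2) ^ 2 := by
        have : 2 * (0.8 * Y / ((K + 3) * Y) ^ 2) ^ 2 = 1.28 * (1 / ((K + 3) ^ 4 * Y ^ 2)) := by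
          field_simp
          norm_num
        rw [this]
        have : 0 ≤ 1 / ((K + 3) ^ 4 * Y ^ 2) := by positivity
        linarith
    _ ≤ _ := by gcongr

end LoewnerFlow

/-- Near every point that is hyperbolically close to the driving function, there is a point that
is swallowed soon. -/
theorem exists_cayleyMap_swallowed {l : ℝ → ℝ} (hl : SmallHolder l) {K : ℝ} (hK : 0 ≤ K) :
    ∃ ρ : ℝ, 0 < ρ ∧ ρ < 1 ∧ ∀ (s : ℝ) (p : ℂ), 0 < p.im → |p.re - l s| ≤ K * p.im →
      ∃ ξ : ℂ, ‖ξ‖ < ρ ∧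
        ¬ ∃ g, LoewnerFlow l s (s + p.im ^ 2 / 16) g ∧ g s = cayleyMap p ξ := by
  have hlc := hl.continuous
  set κ : ℝ := 1 / (16 * (K + 3) ^ 4) with hκ
  have hκ0 : 0 < κ := by positivity
  -- If the whole disc of radius `ρ` survived, Schwarz–Pick would bound the final ratio by `1/(ρ² -
  -- 1/4) = (4/3)(1 + κ/2)`. The flow stretches the initial `4/3` by at least `1 + κ`.
  set ρ : ℝ := √(1 / 4 + 3 / (4 * (1 + κ / 2))) with hρ
  have hρsq : ρ ^ 2 = 1 / 4 + 3 / (4 * (1 + κ / 2)) := Real.sq_sqrt (by positivity)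
  have hρhalf : 1 / 2 < ρ := by
    refine Real.lt_sqrt_of_sq_lt ?_
    have : 0 < 3 / (4 * (1 + κ / 2)) := by positivity
    linarith
  have hρ1 : ρ < 1 := by
    rw [hρ, Real.sqrt_lt' one_pos]
    have : 3 / (4 * (1 + κ / 2)) < 3 / 4 := by
      gcongr
      linarith
    linarith
  refine ⟨ρ, by linarith, hρ1, fun s p hp hKp => ?_⟩
  by_contra hcon
  push Not at hcon
  choose! G hG using hcon
  have hab : s ≤ s + p.im ^ 2 / 16 := by linarith [sq_nonneg p.im]
  set b := s + p.im ^ 2 / 16 with hb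
  have hinv : ∀ ξ, ‖ξ‖ < 1 → (cayleyMap p ξ - p) / (cayleyMap p ξ - conj p) = ξ := by
    intro ξ hξ
    have h1 := one_sub_ne_zero_of_norm_lt hξ
    have h2 : p - conj p ≠ 0 := sub_conj_ne_zero hp hp
    have e1 : cayleyMap p ξ - p = (p - conj p) * ξ / (1 - ξ) := by
      rw [cayleyMap]; field_simp; ring
    have e2 : cayleyMap p ξ - conj p = (p - conj p) / (1 - ξ) := by
      rw [cayleyMap]; field_simp; ring
    rw [e1, e2]
    field_simp
  have hU : IsOpen (cayleyMap p '' Metric.ball 0 ρ) := by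
    have : cayleyMap p '' Metric.ball 0 ρ =
        upperHP ∩ (fun z => (z - p) / (z - conj p)) ⁻¹' Metric.ball 0 ρ := by
      ext z
      constructor
      · rintro ⟨ξ, hξ, rfl⟩
        have hξ1 : ‖ξ‖ < 1 := (mem_ball_zero_iff.1 hξ).trans hρ1
        exact ⟨cayleyMap_im_pos hp hξ1, by rw [mem_preimage, hinv ξ hξ1]; exact hξ⟩
      · rintro ⟨hz, hzb⟩
        refine ⟨_, hzb, ?_⟩
        have h1 := sub_conj_ne_zero hz hp
        have h2 := sub_conj_ne_zero hp hp
        rw [cayleyMap]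
        have h3 : 1 - (z - p) / (z - conj p) = (p - conj p) / (z - conj p) := by
          field_simp; ring
        rw [h3, div_eq_iff (div_ne_zero h2 h1)]
        field_simp
        ring
    rw [this]
    refine ContinuousOn.isOpen_inter_preimage ?_ isOpen_upperHP Metric.isOpen_ball
    refine ContinuousOn.div (by fun_prop) (by fun_prop) fun z hz => sub_conj_ne_zero hz hp
  have hd : DifferentiableOn ℂ (fun ξ => G ξ b) (Metric.ball 0 ρ) := by
    have h1 := differentiableOn_of_flows hlc hab hU
      (G := fun z => G ((z - p) / (z - conj p))) (by
        rintro z ⟨ξ, hξ, rfl⟩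
        rw [hinv ξ ((mem_ball_zero_iff.1 hξ).trans hρ1)]
        exact hG ξ (mem_ball_zero_iff.1 hξ))
    have h2 := h1.comp ((differentiableOn_cayleyMap p).mono (Metric.ball_subset_ball hρ1.le))
      (mapsTo_image _ _)
    refine h2.congr fun ξ hξ => ?_
    simp only [Function.comp_apply]
    rw [hinv ξ ((mem_ball_zero_iff.1 hξ).trans hρ1)]
  have hbI : b ∈ Icc s b := right_mem_Icc.2 hab
  have hschwarz := hypRatio_mul_le hρhalf hd fun ξ hξ => (hG ξ hξ).1.im_pos b hbI
  have h0 := hG 0 (by rw [norm_zero]; linarith)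
  have h2 := hG (1 / 2) (by norm_num at hρhalf ⊢; linarith)
  rw [cayleyMap_zero] at h0
  have hexp := h0.1.hypRatio_mul_le (c := 1 / ((K + 3) ^ 4 * p.im ^ 2)) hab h2.1
    (fun r hr => h0.1.expansion_rate_ge hl hK hp hKp h0.2 hr)
  rw [h0.2, h2.2] at hexp
  have hsymm : ∀ z w : ℂ, hypRatio z w = hypRatio w z := by
    intro z w
    rw [hypRatio, hypRatio, norm_sub_rev, mul_comm z.im]
  rw [hsymm p, hypRatio_cayleyMap_half hp] at hexp
  have hκe : 1 / ((K + 3) ^ 4 * p.im ^ 2) * (b - s) = κ := by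
    rw [hb, hκ]; field_simp; ring
  rw [hκe, hsymm] at hexp
  rw [hρsq] at hschwarz
  have h3 : 4 / 3 * (1 + κ) * (3 / (4 * (1 + κ / 2))) ≤ 1 := by
    refine le_trans ?_ hschwarz
    rw [add_sub_cancel_left]
    gcongr
  rw [mul_div_assoc', div_le_one (by positivity)] at h3
  linarith

/-- The solution of the Loewner equation started at `z` exists up to and including time `t`. -/
def Survives (l : ℝ → ℝ) (t : ℝ) (z : ℂ) : Prop := ∃ g, LoewnerFlow l 0 t g ∧ g 0 = z

theorem Survives.mono {l : ℝ → ℝ} {s t : ℝ} {z : ℂ} (h : Survives l t z) (hst : s ≤ t) :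
    Survives l s z := by
  obtain ⟨g, hg, h0⟩ := h
  exact ⟨g, hg.mono le_rfl hst, h0⟩

theorem survives_backMap {l : ℝ → ℝ} (hl : Continuous l) {t : ℝ} (ht : 0 ≤ t) {w : ℂ}
    (hw : 0 < w.im) : Survives l t (backMap l 0 t w) := by
  obtain ⟨g, hg, rfl⟩ := exists_loewnerFlow_right hl ht hw
  exact ⟨g, hg, (hg.backMap_eq hl ht).symm⟩

theorem not_survives_backMap {l : ℝ → ℝ} (hl : Continuous l) {s t : ℝ} (hs : 0 ≤ s) (hst : s ≤ t)
    {w : ℂ} (hw : 0 < w.im) (hdead : ¬ ∃ g, LoewnerFlow l s t g ∧ g s = w) :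
    ¬ Survives l t (backMap l 0 s w) := by
  rintro ⟨g, hg, h0⟩
  obtain ⟨h, hh, rfl⟩ := exists_loewnerFlow_right hl hs hw
  rw [hh.backMap_eq hl hs] at h0
  exact hdead ⟨g, hg.mono hs le_rfl,
    (hg.mono le_rfl hst).eq_of_eq_left hl hh h0 (right_mem_Icc.2 hs)⟩

/-- Loewner hulls are strictly increasing. -/
theorem exists_survives_not_survives {l : ℝ → ℝ} (hl : SmallHolder l) {a b : ℝ} (ha : 0 ≤ a)
    (hab : a < b) : ∃ z, Survives l a z ∧ ¬ Survives l b z := by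
  obtain ⟨ρ, -, hρ1, h⟩ := exists_cayleyMap_swallowed hl (K := 0) le_rfl
  have hY : 0 < √(b - a) := Real.sqrt_pos.2 (by linarith)
  obtain ⟨ξ, hξ, hdead⟩ := h a ⟨l a, √(b - a)⟩ hY (by simp)
  have hw := cayleyMap_im_pos (p := ⟨l a, √(b - a)⟩) hY (hξ.trans hρ1)
  refine ⟨_, survives_backMap hl.continuous ha hw, fun hb => ?_⟩
  refine not_survives_backMap hl.continuous ha ?_ hw hdead (hb.mono ?_)
  · simp only
    linarith [sq_nonneg (√(b - a))]
  · simp only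
    rw [Real.sq_sqrt (by linarith)]
    linarith

/-- If a trajectory that starts close to a swallowed point `q` gets hyperbolically close to the
driving function, then a point close to `q` is swallowed at about this time. -/
theorem exists_swallowed_near {l : ℝ → ℝ} (hl : SmallHolder l) {K : ℝ} (hK : 0 ≤ K) {q : ℂ}
    (hq : 0 < q.im) {r : ℝ} (hr : 0 < r) : ∃ d > 0, ∀ (s : ℝ) (g : ℝ → ℂ), 0 ≤ s →
      LoewnerFlow l 0 s g → |(g s).re - l s| ≤ K * (g s).im → ¬ Survives l s q →
      ‖g 0 - q‖ < d → ∃ z, ‖z - q‖ < r ∧ Survives l s z ∧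
        ¬ Survives l (s + (g s).im ^ 2 / 16) z := by
  have hlc := hl.continuous
  obtain ⟨ρ, hρ0, hρ1, h⟩ := exists_cayleyMap_swallowed hl hK
  obtain ⟨d, hd0, hd⟩ := exists_dist_lt_of_omits hq hρ0 hρ1 hr
  refine ⟨d, hd0, fun s g hs hg hKg hqdead hgq => ?_⟩
  have hp : 0 < (g s).im := hg.im_pos s (right_mem_Icc.2 hs)
  obtain ⟨ξ, hξ, hdead⟩ := h s (g s) hp hKg
  have him : ∀ ζ, ‖ζ‖ < 1 → 0 < (cayleyMap (g s) ζ).im := fun ζ hζ => cayleyMap_im_pos hp hζ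
  have hw := him ξ (hξ.trans hρ1)
  refine ⟨backMap l 0 s (cayleyMap (g s) ξ), ?_, survives_backMap hlc hs hw,
    not_survives_backMap hlc hs (by linarith [sq_nonneg (g s).im]) hw hdead⟩
  -- All values of this map survive up to time `s`, so it omits `q`, and it sends 0 to `g 0`.
  refine hd (fun ζ => backMap l 0 s (cayleyMap (g s) ζ)) ?_ ?_ ?_ ?_ ξ hξ.le
  · exact (differentiableOn_backMap hlc hs).comp (differentiableOn_cayleyMap _)
      fun ζ hζ => him ζ (mem_ball_zero_iff.1 hζ)
  · exact fun ζ hζ => backMap_im_pos hlc hs (him ζ hζ)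
  · intro ζ hζ heq
    exact hqdead (heq ▸ survives_backMap hlc hs (him ζ hζ))
  · rwa [cayleyMap_zero, hg.backMap_eq hlc hs]

/-- `T` is the time at which `z` is swallowed. -/
structure IsLifetime (l : ℝ → ℝ) (z : ℂ) (T : ℝ) : Prop where
  pos : 0 < T
  survives : ∀ r < T, Survives l r z
  not_survives : ¬ Survives l T z

theorem LoewnerFlow.survives_add {l : ℝ → ℝ} (hl : Continuous l) {t : ℝ} (ht : 0 ≤ t) {g : ℝ → ℂ}
    (hg : LoewnerFlow l 0 t g) : Survives l (t + (g t).im ^ 2 / 8) (g 0) := by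
  obtain ⟨h, hh, hht⟩ := exists_loewnerFlow hl ht (hg.im_pos t (right_mem_Icc.2 ht))
  refine ⟨h, hh, ?_⟩
  exact (hh.mono le_rfl (by linarith [sq_nonneg (g t).im])).eq_of_eq_right hl hg hht
    (left_mem_Icc.2 ht)

theorem survives_zero {l : ℝ → ℝ} (hl : Continuous l) {z : ℂ} (hz : 0 < z.im) :
    Survives l 0 z := by
  obtain ⟨g, hg, h0⟩ := exists_loewnerFlow_right hl le_rfl hz
  exact ⟨g, hg, h0⟩

theorem exists_isLifetime {l : ℝ → ℝ} (hl : Continuous l) {z : ℂ} (hz : 0 < z.im) {t : ℝ}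
    (h : ¬ Survives l t z) : ∃ T, IsLifetime l z T ∧ T ≤ t := by
  set A := {r : ℝ | 0 ≤ r ∧ Survives l r z} with hA
  have h0 : (0 : ℝ) ∈ A := ⟨le_rfl, survives_zero hl hz⟩
  have hbdd : ∀ r ∈ A, r ≤ t := by
    intro r hr
    by_contra hlt
    exact h (hr.2.mono (not_le.1 hlt).le)
  have hB : BddAbove A := ⟨t, hbdd⟩
  have hnot : ∀ r ∈ A, r < sSup A := by
    rintro r ⟨hr0, g, hg, rfl⟩
    have him := hg.im_pos r (right_mem_Icc.2 hr0)
    have hpos : 0 < (g r).im ^ 2 / 8 := by positivity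
    have := le_csSup hB (⟨by linarith, hg.survives_add hl hr0⟩ : r + (g r).im ^ 2 / 8 ∈ A)
    linarith
  refine ⟨sSup A, ⟨hnot 0 h0, fun r hr => ?_, fun hs => ?_⟩, csSup_le ⟨0, h0⟩ hbdd⟩
  · obtain ⟨r', hr', hlt⟩ := exists_lt_of_lt_csSup ⟨0, h0⟩ hr
    exact hr'.2.mono hlt.le
  · exact lt_irrefl _ (hnot _ ⟨(hnot 0 h0).le, hs⟩)

theorem LoewnerFlow.im_mul_exp_le {l : ℝ → ℝ} {a b : ℝ} {g : ℝ → ℂ} (h : LoewnerFlow l a b g)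
    (hab : a ≤ b) {ε : ℝ} (hε : 0 < ε) (hd : ∀ s ∈ Icc a b, ε ≤ ‖g s - l s‖) :
    (g a).im * Real.exp (-(2 / ε ^ 2) * (b - a)) ≤ (g b).im := by
  have hmono : MonotoneOn (fun s => (g s).im * Real.exp (2 / ε ^ 2 * (s - a))) (Icc a b) := by
    have hder : ∀ s ∈ Icc a b, HasDerivWithinAt
        (fun s => (g s).im * Real.exp (2 / ε ^ 2 * (s - a)))
        ((-(2 * (g s).im) / (((g s).re - l s) ^ 2 + (g s).im ^ 2)) *
          Real.exp (2 / ε ^ 2 * (s - a)) +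
          (g s).im * (Real.exp (2 / ε ^ 2 * (s - a)) * (2 / ε ^ 2))) (Icc a b) s := by
      intro s hs
      have h1 := ((hasDerivWithinAt_id s (Icc a b)).sub_const a).const_mul (2 / ε ^ 2)
      rw [mul_one] at h1
      exact (h.deriv_im hs).mul h1.exp
    refine monotoneOn_of_hasDerivWithinAt_nonneg (convex_Icc a b)
      (fun s hs => (hder s hs).continuousWithinAt)
      (fun s hs => (hder s (interior_subset hs)).mono interior_subset) ?_
    intro s hs
    have hs' := interior_subset hs
    have hp := h.im_pos s hs'
    have hn : ε ^ 2 ≤ ((g s).re - l s) ^ 2 + (g s).im ^ 2 := by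
      have h1 := pow_le_pow_left₀ hε.le (hd s hs') 2
      rw [Complex.sq_norm, Complex.normSq_apply] at h1
      simp only [Complex.sub_re, Complex.ofReal_re, Complex.sub_im, Complex.ofReal_im,
        sub_zero] at h1
      linarith
    have h2 : 2 * (g s).im / (((g s).re - l s) ^ 2 + (g s).im ^ 2) ≤ 2 * (g s).im / ε ^ 2 := by
      gcongr
    have h3 : 0 ≤ Real.exp (2 / ε ^ 2 * (s - a)) *
        (2 * (g s).im / ε ^ 2 - 2 * (g s).im / (((g s).re - l s) ^ 2 + (g s).im ^ 2)) :=
      mul_nonneg (Real.exp_pos _).le (by linarith)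
    rw [neg_div]
    calc (0 : ℝ) ≤ _ := h3
      _ = _ := by ring
  have h1 := hmono (left_mem_Icc.2 hab) (right_mem_Icc.2 hab) hab
  simp only [sub_self, mul_zero, Real.exp_zero, mul_one] at h1
  calc (g a).im * Real.exp (-(2 / ε ^ 2) * (b - a))
      ≤ (g b).im * Real.exp (2 / ε ^ 2 * (b - a)) * Real.exp (-(2 / ε ^ 2) * (b - a)) := by gcongr
    _ = (g b).im := by
      rw [mul_assoc, ← Real.exp_add]
      simp

/-- A trajectory that stayed at distance `ε` from the driving function would keep its imaginary part
above some `m > 0`; restarted within `m ^ 2 / 16` of `T`, it would survive past `T`. -/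
theorem IsLifetime.exists_near {l : ℝ → ℝ} (hl : Continuous l) {z : ℂ} {T : ℝ}
    (hT : IsLifetime l z T) {ε : ℝ} (hε : 0 < ε) : ∃ r g, 0 ≤ r ∧ T - ε < r ∧ r < T ∧
      LoewnerFlow l 0 r g ∧ g 0 = z ∧ ‖g r - l r‖ ≤ ε := by
  by_contra! hcon
  set r₀ := max 0 (T - ε / 2) with hr₀
  have hr₀0 : 0 ≤ r₀ := le_max_left _ _
  have hr₀T : r₀ < T := max_lt hT.pos (by linarith)
  have hr₀ε : T - ε < r₀ := lt_of_lt_of_le (by linarith) (le_max_right _ _)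
  obtain ⟨g₀, hg₀, hz₀⟩ := hT.survives r₀ hr₀T
  have hp := hg₀.im_pos r₀ (right_mem_Icc.2 hr₀0)
  set m := (g₀ r₀).im * Real.exp (-(2 / ε ^ 2) * (T - r₀)) with hm
  have hm0 : 0 < m := by positivity
  set r := max r₀ (T - m ^ 2 / 16) with hr
  have hrT : r < T := max_lt hr₀T (by linarith [sq_pos_of_pos hm0])
  have hr0r : r₀ ≤ r := le_max_left _ _
  obtain ⟨g, hg, hgz⟩ := hT.survives r hrT
  have hagree : g r₀ = g₀ r₀ := (hg.mono le_rfl hr0r).eq_of_eq_left hl hg₀ (hgz.trans hz₀.symm)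
    (right_mem_Icc.2 hr₀0)
  have him := (hg.mono hr₀0 le_rfl).im_mul_exp_le hr0r hε fun s hs =>
    (hcon s g (hr₀0.trans hs.1) (hr₀ε.trans_le hs.1) (hs.2.trans_lt hrT) (hg.mono le_rfl hs.2)
      hgz).le
  have hmle : m ≤ (g r).im := by
    refine le_trans ?_ him
    rw [hagree, hm]
    refine mul_le_mul_of_nonneg_left (Real.exp_le_exp.2 ?_) hp.le
    have : 0 ≤ 2 / ε ^ 2 := by positivity
    nlinarith
  refine hT.not_survives ?_
  rw [← hgz]
  refine (hg.survives_add hl (hr₀0.trans hr0r)).mono ?_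
  have h1 : T - m ^ 2 / 16 ≤ r := le_max_right _ _
  have h2 := pow_le_pow_left₀ hm0.le hmle 2
  linarith [sq_nonneg m]

/-! ### Boundary points of the hull and capture times -/

/-- The first time after `t` at which a trajectory gets hyperbolically close to the driving
function, or else a time just before it is swallowed. -/
theorem IsLifetime.exists_first_near {l : ℝ → ℝ} (hl : Continuous l) {z : ℂ} {t T : ℝ} (ht : 0 ≤ t)
    (htT : t < T) (hT : IsLifetime l z T) (K : ℝ) {ε : ℝ} (hε : 0 < ε) :
    ∃ s g, t ≤ s ∧ s < T ∧ LoewnerFlow l 0 s g ∧ g 0 = z ∧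
      (∀ r ∈ Ico t s, K * (g r).im < |(g r).re - l r|) ∧
      (|(g s).re - l s| ≤ K * (g s).im ∨ (|(g s).re - l s| ≤ ε ∧ T - s < ε)) := by
  obtain ⟨r, g, hr0, hr1, hrT, hg, hgz, hgr⟩ :=
    hT.exists_near hl (ε := min ε (T - t)) (lt_min hε (by linarith))
  have htr : t ≤ r := by linarith [min_le_right ε (T - t)]
  set A := {s ∈ Icc t r | |(g s).re - l s| ≤ K * (g s).im} with hA
  have hgc : ContinuousOn g (Icc t r) := hg.continuousOn.mono (Icc_subset_Icc ht le_rfl)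
  have hAc : IsCompact A := by
    have hclosed : IsClosed A := by
      have c1 : ContinuousOn (fun s => |(g s).re - l s|) (Icc t r) :=
        ((Complex.continuous_re.comp_continuousOn hgc).sub hl.continuousOn).abs
      have c2 : ContinuousOn (fun s => K * (g s).im) (Icc t r) :=
        continuousOn_const.mul (Complex.continuous_im.comp_continuousOn hgc)
      exact isClosed_Icc.isClosed_le c1 c2
    exact isCompact_Icc.of_isClosed_subset hclosed fun s hs => hs.1
  rcases A.eq_empty_or_nonempty with hne | hne
  · refine ⟨r, g, htr, hrT, hg, hgz, fun s hs => ?_, Or.inr ⟨?_, ?_⟩⟩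
    · by_contra hle
      exact (hne ▸ (⟨⟨hs.1, hs.2.le⟩, not_lt.1 hle⟩ : s ∈ A) : s ∈ (∅ : Set ℝ))
    · refine le_trans ?_ (hgr.trans (min_le_left _ _))
      have := Complex.abs_re_le_norm (g r - l r)
      simpa using this
    · linarith [min_le_left ε (T - t)]
  · obtain ⟨s, hsA, hmin⟩ := hAc.exists_isLeast hne
    refine ⟨s, g, hsA.1.1, hsA.1.2.trans_lt hrT, hg.mono le_rfl hsA.1.2, hgz, fun x hx => ?_,
      Or.inl hsA.2⟩
    by_contra hle
    exact absurd (hmin ⟨⟨hx.1, hx.2.le.trans hsA.1.2⟩, not_lt.1 hle⟩) (not_le.2 hx.2)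

/-- Trajectories that start close to a swallowed point are close to the real line. -/
theorem exists_im_lt {l : ℝ → ℝ} (hl : Continuous l) {t : ℝ} (ht : 0 ≤ t) {q : ℂ}
    (hq : ¬ Survives l t q) {ε : ℝ} (hε : 0 < ε) :
    ∃ δ > 0, ∀ g, LoewnerFlow l 0 t g → ‖g 0 - q‖ < δ → (g t).im < ε := by
  by_contra! hcon
  choose g hg hgq him using fun n : ℕ => hcon (1 / (n + 1)) Nat.one_div_pos_of_nat
  have h0I : (0 : ℝ) ∈ Icc 0 t := left_mem_Icc.2 ht
  have htI : t ∈ Icc 0 t := right_mem_Icc.2 ht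
  have hmove : ∀ n, ‖g n t - g n 0‖ ≤ 2 / ε * t := by
    intro n
    have := Convex.norm_image_sub_le_of_norm_hasDerivWithin_le (C := 2 / ε) (hg n).deriv
      (fun x hx => by
        rw [norm_div, Complex.norm_two]
        have := (him n).trans ((hg n).im_le_norm hx)
        gcongr) (convex_Icc _ _) h0I htI
    rwa [Real.norm_of_nonneg (by linarith), sub_zero] at this
  have hmem : ∀ n, g n t ∈ Metric.closedBall q (2 / ε * t + 1) ∩ {w : ℂ | ε ≤ w.im} := by
    intro n
    refine ⟨?_, him n⟩
    rw [Metric.mem_closedBall, dist_eq_norm]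
    have h1 : (1 : ℝ) / (n + 1) ≤ 1 := by
      rw [div_le_one (by positivity)]
      linarith [(Nat.cast_nonneg n : (0 : ℝ) ≤ n)]
    have h2 := norm_add_le (g n t - g n 0) (g n 0 - q)
    rw [sub_add_sub_cancel] at h2
    linarith [hmove n, hgq n]
  -- A limit point of the positions at time `t` stays in the half-plane, and `backMap` sends it to
  -- `q`, which would then survive.
  have hcomp : IsCompact (Metric.closedBall q (2 / ε * t + 1) ∩ {w : ℂ | ε ≤ w.im}) :=
    (isCompact_closedBall _ _).inter_right (isClosed_le continuous_const Complex.continuous_im)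
  obtain ⟨w, hw, φ, hφ, hlim⟩ := hcomp.tendsto_subseq hmem
  have hw0 : 0 < w.im := hε.trans_le hw.2
  obtain ⟨c, -, hc⟩ := exists_hasDerivAt_backMap hl ht hw0
  have h1 := hc.continuousAt.tendsto.comp hlim
  have h2 : Filter.Tendsto (fun n => g (φ n) 0) Filter.atTop (nhds q) := by
    rw [tendsto_iff_norm_sub_tendsto_zero]
    refine squeeze_zero (fun _ => norm_nonneg _) (fun n => (hgq (φ n)).le) ?_
    exact (tendsto_one_div_add_atTop_nhds_zero_nat (𝕜 := ℝ)).comp hφ.tendsto_atTop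
  have h3 : (backMap l 0 t ∘ (fun n => g n t) ∘ φ) = fun n => g (φ n) 0 := by
    funext n
    exact (hg (φ n)).backMap_eq hl ht
  rw [h3] at h1
  have := tendsto_nhds_unique h1 h2
  exact hq (this ▸ survives_backMap hl ht hw0)

/-- A trajectory that stays hyperbolically far from the driving function gives a path as in the
definition of `RightCapture`, possibly after a reflection. -/
theorem LoewnerFlow.exists_path {l : ℝ → ℝ} (hl : Continuous l) {t s : ℝ} (hts : t < s)
    {g : ℝ → ℂ} (hg : LoewnerFlow l t s g)
    (hfar : ∀ r ∈ Ico t s, 1000 * (g r).im < |(g r).re - l r|) :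
    ∃ σ : ℝ, (σ = 1 ∨ σ = -1) ∧ ContinuousOn (fun r => σ * (g r).re) (Icc t s) ∧
      0 ≤ σ * (g s).re - σ * l s ∧ σ * (g s).re - σ * l s ≤ |(g s).re - l s| ∧
      ∃ X' : ℝ → ℝ, ∀ r ∈ Ioo t s, HasDerivAt (fun r => σ * (g r).re) (X' r) r ∧
        0 < σ * (g r).re - σ * l r ∧ 1.999998 / (σ * (g r).re - σ * l r) ≤ X' r ∧
        X' r ≤ 2 / (σ * (g r).re - σ * l r) := by
  have hre : ContinuousOn (fun r => (g r).re) (Icc t s) :=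
    Complex.continuous_re.comp_continuousOn hg.continuousOn
  have hc : ContinuousOn (fun r => (g r).re - l r) (Icc t s) := hre.sub hl.continuousOn
  have hne : ∀ r ∈ Ico t s, (g r).re - l r ≠ 0 := by
    intro r hr h0
    have h1 := hfar r hr
    have h2 := hg.im_pos r (Ico_subset_Icc_self hr)
    rw [h0, abs_zero] at h1
    linarith
  obtain ⟨σ, hσ, hσpos⟩ : ∃ σ : ℝ, (σ = 1 ∨ σ = -1) ∧
      ∀ r ∈ Ico t s, 0 < σ * ((g r).re - l r) := by
    have hsign : ∀ r ∈ Ico t s, 0 < ((g t).re - l t) * ((g r).re - l r) := by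
      intro r hr
      by_contra hle
      have hcr := hc.mono (Icc_subset_Icc (le_refl t) hr.2.le)
      have h0 : (0 : ℝ) ∈ uIcc ((g t).re - l t) ((g r).re - l r) := by
        rw [mem_uIcc]
        rcases lt_or_gt_of_ne (hne t ⟨le_rfl, hts⟩) with h | h
        · left; refine ⟨h.le, ?_⟩
          by_contra h'
          exact hle (mul_pos_of_neg_of_neg h (not_le.1 h'))
        · right; refine ⟨?_, h.le⟩
          by_contra h'
          exact hle (mul_pos h (not_le.1 h'))
      have := intermediate_value_uIcc (f := fun r => (g r).re - l r) (a := t) (b := r)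
        (by rwa [uIcc_of_le hr.1]) h0
      obtain ⟨x, hx, hx0⟩ := this
      rw [uIcc_of_le hr.1] at hx
      exact hne x ⟨hx.1, hx.2.trans_lt hr.2⟩ hx0
    rcases lt_or_gt_of_ne (hne t ⟨le_rfl, hts⟩) with h | h
    · refine ⟨-1, Or.inr rfl, fun r hr => ?_⟩
      have := hsign r hr
      have := neg_of_mul_pos_right this h.le
      linarith
    · refine ⟨1, Or.inl rfl, fun r hr => ?_⟩
      have := pos_of_mul_pos_right (hsign r hr) h.le
      linarith
  have hσsq : σ * σ = 1 := by rcases hσ with h | h <;> rw [h] <;> norm_num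
  have hσabs : |σ| = 1 := by rcases hσ with h | h <;> rw [h] <;> norm_num
  refine ⟨σ, hσ, continuousOn_const.mul hre, ?_, ?_, ?_⟩
  · by_contra hneg
    rw [← mul_sub, not_le] at hneg
    have h0 : (0 : ℝ) ∈ Icc (σ * ((g s).re - l s)) (σ * ((g t).re - l t)) :=
      ⟨hneg.le, (hσpos t ⟨le_rfl, hts⟩).le⟩
    obtain ⟨x, hx, hx0⟩ := intermediate_value_Icc' hts.le (continuousOn_const.mul hc) h0
    rcases eq_or_lt_of_le hx.2 with h | h
    · rw [h] at hx0
      exact hneg.ne hx0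
    · exact (hσpos x ⟨hx.1, h⟩).ne' hx0
  · rw [← mul_sub]
    refine (le_abs_self _).trans ?_
    rw [abs_mul, hσabs, one_mul]
  · refine ⟨fun r => σ * (2 * ((g r).re - l r) / (((g r).re - l r) ^ 2 + (g r).im ^ 2)),
      fun r hr => ?_⟩
    have hrI : r ∈ Icc t s := Ioo_subset_Icc_self hr
    have hu := hσpos r ⟨hr.1.le, hr.2⟩
    have hf := hfar r ⟨hr.1.le, hr.2⟩
    have hy := hg.im_pos r hrI
    rw [← mul_sub]
    have habs : |(g r).re - l r| = σ * ((g r).re - l r) := by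
      rw [← abs_of_pos hu, abs_mul, hσabs, one_mul]
    rw [habs] at hf
    set u := σ * ((g r).re - l r) with hudef
    have hre2 : ((g r).re - l r) ^ 2 = u ^ 2 := by
      rw [hudef]; linear_combination -((g r).re - l r) ^ 2 * hσsq
    have hX : σ * (2 * ((g r).re - l r) / (((g r).re - l r) ^ 2 + (g r).im ^ 2)) =
        2 * u / (u ^ 2 + (g r).im ^ 2) := by
      rw [hre2, hudef]; ring
    refine ⟨((hg.deriv_re hrI).hasDerivAt (Icc_mem_nhds hr.1 hr.2)).const_mul σ, hu, ?_, ?_⟩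
    -- As the height is below `u / 1000`, the speed is at least `2/((1 + 1e-6) u)`, which exceeds
    -- `1.999998 / u`.
    · beta_reduce
      rw [hX]
      rw [div_le_div_iff₀ hu (by positivity)]
      nlinarith
    · beta_reduce
      rw [hX]
      rw [div_le_div_iff₀ (by positivity) hu]
      nlinarith [sq_nonneg (g r).im]

/-- A boundary point `q` of the hull at time `t`, in a region where every point is visited by `γ`
at the time when it is swallowed, is visited at a time that is a limit of capture times. -/
theorem exists_capture_time {l : ℝ → ℝ} (hl : SmallHolder l) {Tm t : ℝ} (ht : 0 ≤ t) {γ : ℝ → ℂ}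
    (hγ : ContinuousOn γ (Icc 0 Tm)) {B : Set ℂ} (hB : IsOpen B) (hBim : B ⊆ upperHP)
    (hdead : ∀ z ∈ B, ¬ Survives l Tm z) (hlife : ∀ z ∈ B, ∀ T, IsLifetime l z T → γ T = z)
    {q : ℂ} (hq : q ∈ B) (hqt : ¬ Survives l t q)
    (hqc : q ∈ closure (B ∩ {z | Survives l t z})) :
    ∃ S ∈ Icc t Tm, γ S = q ∧
      (t < S → RightCapture l t S ∨ RightCapture (fun s => -l s) t S) := by
  have hlc := hl.continuous
  have hlife' : ∀ z ∈ B, ∃ T, IsLifetime l z T ∧ T ≤ Tm ∧ γ T = z := by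
    intro z hz
    obtain ⟨T, hT, hTle⟩ := exists_isLifetime hlc (hBim hz) (hdead z hz)
    exact ⟨T, hT, hTle, hlife z hz T hT⟩
  have hseq : ∀ n : ℕ, ∃ (s T : ℝ) (g : ℝ → ℂ), t ≤ s ∧ s < T ∧ T ≤ Tm ∧ IsLifetime l (g 0) T ∧
      LoewnerFlow l 0 s g ∧ (∀ r ∈ Ico t s, 1000 * (g r).im < |(g r).re - l r|) ∧
      (|(g s).re - l s| ≤ 1000 * (g s).im ∨
        (|(g s).re - l s| ≤ 1 / ((n : ℝ) + 1) ∧ T - s < 1 / ((n : ℝ) + 1))) ∧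
      (g t).im < 1 / ((n : ℝ) + 1) / 1000 ∧ g 0 ∈ B ∧ ‖g 0 - q‖ < 1 / ((n : ℝ) + 1) := by
    intro n
    have hε : (0 : ℝ) < 1 / ((n : ℝ) + 1) := Nat.one_div_pos_of_nat
    obtain ⟨δ, hδ0, hδ⟩ := exists_im_lt hlc ht hqt (ε := 1 / ((n : ℝ) + 1) / 1000) (by positivity)
    obtain ⟨z, ⟨hzB, hzt⟩, hzq⟩ := Metric.mem_closure_iff.1 hqc (min δ (1 / ((n : ℝ) + 1)))
      (lt_min hδ0 hε)
    rw [dist_comm, dist_eq_norm] at hzq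
    obtain ⟨T, hT, hTm, -⟩ := hlife' z hzB
    have htT : t < T := by
      by_contra hle
      exact hT.not_survives (hzt.mono (not_lt.1 hle))
    obtain ⟨s, g, hts, hsT, hg, rfl, hfar, hnear⟩ := hT.exists_first_near hlc ht htT 1000 hε
    exact ⟨s, T, g, hts, hsT, hTm, hT, hg, hfar, hnear,
      hδ g (hg.mono le_rfl hts) (hzq.trans_le (min_le_left _ _)), hzB,
      hzq.trans_le (min_le_right _ _)⟩
  choose s T g hts hsT hTm hT hg hfar hnear him hgB hgq using hseq
  have hε0 : ∀ n : ℕ, (0 : ℝ) < 1 / ((n : ℝ) + 1) := fun n => Nat.one_div_pos_of_nat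
  obtain ⟨S, hS, φ, hφ, hlim⟩ := isCompact_Icc.tendsto_subseq (x := s) (s := Icc t Tm)
    fun n => ⟨hts n, (hsT n).le.trans (hTm n)⟩
  have hlim1 : ∀ ε > (0 : ℝ), ∀ᶠ n in Filter.atTop, |s (φ n) - S| < ε :=
    fun ε hε => (Metric.tendsto_nhds.1 hlim) ε hε
  have hlim2 : ∀ ε > (0 : ℝ), ∀ᶠ n in Filter.atTop, 1 / ((φ n : ℝ) + 1) < ε := by
    intro ε hε
    have := (tendsto_one_div_add_atTop_nhds_zero_nat (𝕜 := ℝ)).comp hφ.tendsto_atTop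
    exact this.eventually (gt_mem_nhds hε)
  have himle : ∀ n, (g n (s n)).im ≤ (g n t).im := fun n =>
    (hg n).im_antitoneOn ⟨ht, hts n⟩ ⟨ht.trans (hts n), le_rfl⟩ (hts n)
  have himp : ∀ n, 0 < (g n (s n)).im := fun n => (hg n).im_pos _ ⟨ht.trans (hts n), le_rfl⟩
  refine ⟨S, hS, ?_, fun htS => ?_⟩
  · by_contra hne
    have hS0 : S ∈ Icc 0 Tm := ⟨ht.trans hS.1, hS.2⟩
    set ρ := ‖γ S - q‖ / 2 with hρ
    have hρ0 : 0 < ρ := by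
      have := norm_pos_iff.2 (sub_ne_zero.2 hne)
      positivity
    obtain ⟨r₁, hr₁, hrB⟩ := Metric.isOpen_iff.1 hB q hq
    set r := min r₁ ρ with hr
    have hr0 : 0 < r := lt_min hr₁ hρ0
    obtain ⟨η, hη0, hη⟩ := Metric.continuousOn_iff.1 hγ S hS0 ρ hρ0
    -- No point near `q` is swallowed near time `S`: the curve would visit it then, while it is
    -- still close to `γ S`.
    have havoid : ∀ z, ‖z - q‖ < r → ∀ T', IsLifetime l z T' → |T' - S| < η → False := by
      intro z hz T' hT' hTS
      have hzB : z ∈ B := hrB (mem_ball_iff_norm.2 (hz.trans_le (min_le_left _ _)))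
      obtain ⟨T'', hT'', hle, hγz⟩ := hlife' z hzB
      have hTT : T' ≤ T'' := by
        by_contra hlt
        exact hT''.not_survives (hT'.survives _ (not_le.1 hlt))
      have hd := hη T' ⟨hT'.pos.le, hTT.trans hle⟩ hTS
      rw [hlife z hzB T' hT', dist_eq_norm] at hd
      have h1 := norm_sub_le_norm_sub_add_norm_sub (γ S) z q
      rw [norm_sub_rev (γ S) z] at h1
      have h2 := hz.trans_le (min_le_right _ _)
      linarith
    obtain ⟨d, hd0, hd⟩ := exists_swallowed_near hl (K := 1000) (by norm_num) (hBim hq) hr0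
    obtain ⟨n, hn1, hn2, hn3⟩ := ((hlim1 (η / 2) (by positivity)).and
      ((hlim2 (min (min d r) (η / 2)) (by positivity)).and (hlim2 1 one_pos))).exists
    set m := φ n with hm
    have hn4 := hn2.trans_le ((min_le_left _ _).trans (min_le_left _ _))
    have hn5 := hn2.trans_le ((min_le_left _ _).trans (min_le_right _ _))
    have hn6 := hn2.trans_le (min_le_right _ _)
    rw [abs_lt] at hn1
    rcases hnear m with hK | ⟨-, hK⟩
    · obtain ⟨z, hzr, hz1, hz2⟩ := hd (s m) (g m) (ht.trans (hts m)) (hg m) hK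
        (fun h => hqt (h.mono (hts m))) ((hgq m).trans hn4)
      have hzB : z ∈ B := hrB (mem_ball_iff_norm.2 (hzr.trans_le (min_le_left _ _)))
      obtain ⟨T', hT', hTle⟩ := exists_isLifetime hlc (hBim hzB) hz2
      have hsT' : s m < T' := by
        by_contra hle
        exact hT'.not_survives (hz1.mono (not_lt.1 hle))
      refine havoid z hzr T' hT' ?_
      have h1 : (g m (s m)).im < 1 / ((m : ℝ) + 1) := by
        have := (himle m).trans_lt (him m)
        have := hε0 m
        linarith
      have h2 : (g m (s m)).im ^ 2 ≤ 1 / ((m : ℝ) + 1) := by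
        have := himp m
        nlinarith
      rw [abs_lt]
      constructor <;> linarith
    · refine havoid (g m 0) ((hgq m).trans hn5) (T m) (hT m) ?_
      have := hsT m
      rw [abs_lt]
      constructor <;> linarith
  -- Up to time `s m` the trajectory is almost real and on one side of the driving function, and it
  -- ends close to it: the sign `σ` selects the alternative.
  · by_contra! hno
    obtain ⟨h1, h2⟩ := hno
    rw [RightCapture] at h1 h2
    push Not at h1 h2
    obtain ⟨ε₁, hε₁, h1⟩ := h1
    obtain ⟨ε₂, hε₂, h2⟩ := h2
    obtain ⟨n, hn1, hn2⟩ := ((hlim1 (min (min ε₁ ε₂) (S - t)) (by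
      have : 0 < S - t := by linarith
      positivity)).and (hlim2 (min ε₁ ε₂) (by positivity))).exists
    set m := φ n with hm
    have a1 := hn1.trans_le ((min_le_left _ _).trans (min_le_left _ _))
    have a2 := hn1.trans_le ((min_le_left _ _).trans (min_le_right _ _))
    have a3 := (abs_lt.1 (hn1.trans_le (min_le_right _ _))).1
    have b1 := hn2.trans_le (min_le_left _ _)
    have b2 := hn2.trans_le (min_le_right _ _)
    obtain ⟨σ, hσ, c, hnn, hle, X', hX'⟩ :=
      ((hg m).mono ht le_rfl).exists_path hlc (by linarith) (hfar m)
    have hsmall : |(g m (s m)).re - l (s m)| ≤ 1 / ((m : ℝ) + 1) := by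
      rcases hnear m with h | h
      · have := (himle m).trans_lt (him m)
        linarith
      · exact h.1
    rcases hσ with rfl | rfl
    · refine absurd (h1 (s m) (fun r => (g m r).re) X' a1 ?_ ?_ ?_) ?_
      · simpa using c
      · simpa using hX'
      · simpa using hnn
      · have := hle.trans (hsmall.trans b1.le)
        simpa using this
    · refine absurd (h2 (s m) (fun r => -1 * (g m r).re) X' a2 c ?_ ?_) ?_
      · simpa only [neg_one_mul] using hX'
      · simpa only [neg_one_mul] using hnn
      · have := hle.trans (hsmall.trans b2.le)
        simpa only [neg_one_mul, not_lt] using this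

/-- If the hulls driven by `l` are generated by `γ`, then points of the half-plane on the curve are
visited at the time when they are swallowed. -/
theorem apply_lifetime_eq {l : ℝ → ℝ} (hl : SmallHolder l) {Tm : ℝ} {γ : ℝ → ℂ}
    (hγ : ContinuousOn γ (Icc 0 Tm))
    (hhull : ∀ t ∈ Icc 0 Tm, ∀ z, Survives l t z ↔ z ∈ unboundedComponent (γ '' Icc 0 t))
    {z : ℂ} (hz : 0 < z.im) (hzγ : z ∈ γ '' Icc 0 Tm) {T : ℝ} (hT : IsLifetime l z T) :
    γ T = z := by
  have hout : ∀ t ∈ Icc 0 Tm, ∀ w, Survives l t w → w ∉ γ '' Icc 0 t := by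
    intro t ht w hw hwγ
    refine (hhull t ht w).1 hw ?_
    rw [connectedComponentIn_eq_empty fun h => h.2 hwγ]
    exact Bornology.isBounded_empty
  by_contra hne
  obtain ⟨r, hr, hrz⟩ := hzγ
  have hTr : T < r := by
    rcases lt_trichotomy T r with h | h | h
    · exact h
    · exact absurd (h ▸ hrz) hne
    · exact absurd ⟨r, ⟨hr.1, le_rfl⟩, hrz⟩ (hout r hr z (hT.survives r h))
  have hTI : T ∈ Icc 0 Tm := ⟨hT.pos.le, hTr.le.trans hr.2⟩
  have hzT : z ∉ γ '' Icc 0 T := by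
    rintro ⟨x, hx, hxz⟩
    rcases eq_or_lt_of_le hx.2 with h | h
    · exact hne (h ▸ hxz)
    · exact hout x ⟨hx.1, hx.2.trans hTI.2⟩ z (hT.survives x h) ⟨x, ⟨hx.1, le_rfl⟩, hxz⟩
  have hcl : ∀ t ∈ Icc 0 Tm, IsClosed (γ '' Icc 0 t) := fun t ht =>
    (isCompact_Icc.image_of_continuousOn (hγ.mono (Icc_subset_Icc le_rfl ht.2))).isClosed
  set V := upperHP \ γ '' Icc 0 T with hV
  have hVo : IsOpen V := isOpen_upperHP.sdiff (hcl T hTI)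
  set O := connectedComponentIn V z with hO
  have hOo : IsOpen O := hVo.connectedComponentIn
  have hzO : z ∈ O := mem_connectedComponentIn ⟨hz, hzT⟩
  have hOb : Bornology.IsBounded O := by
    by_contra h
    exact hT.not_survives ((hhull T hTI z).2 h)
  obtain ⟨η, hη0, hη⟩ : ∃ η > 0, ∀ x ∈ Icc 0 Tm, |x - r| < η → γ x ∈ O := by
    obtain ⟨ε, hε0, hε⟩ := Metric.isOpen_iff.1 hOo z hzO
    obtain ⟨η, hη0, hη⟩ := Metric.continuousOn_iff.1 hγ r hr ε hε0
    exact ⟨η, hη0, fun x hx hxr => hε (hrz ▸ hη x hx hxr)⟩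
  -- On `[a, r]` the curve runs inside `O`, which is already swallowed, so it cannot touch the
  -- unbounded component at time `a`. The hull would not grow on `[a, r]`, against
  -- `exists_survives_not_survives`.
  set a := max T (r - η / 2) with ha
  have haT : T ≤ a := le_max_left _ _
  have har : a < r := max_lt hTr (by linarith)
  have haI : a ∈ Icc 0 Tm := ⟨hTI.1.trans haT, har.le.trans hr.2⟩
  obtain ⟨w, hwa, hwr⟩ := exists_survives_not_survives hl haI.1 har
  refine hwr ((hhull r hr w).2 ?_)
  have hwU := (hhull a haI w).1 hwa
  set C := connectedComponentIn (upperHP \ γ '' Icc 0 a) w with hC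
  have hwC : w ∈ C := by
    by_contra h
    have : C = ∅ := by
      by_contra hne
      exact h (mem_connectedComponentIn
        (connectedComponentIn_nonempty_iff.1 (nonempty_iff_ne_empty.2 hne)))
    refine hwU ?_
    rw [← hC, this]
    exact Bornology.isBounded_empty
  have hdisj : ∀ y ∈ C, y ∉ O := by
    intro y hyC hyO
    have h1 : y ∈ unboundedComponent (γ '' Icc 0 a) := by
      change ¬ Bornology.IsBounded (connectedComponentIn (upperHP \ γ '' Icc 0 a) y)
      rw [← connectedComponentIn_eq hyC]
      exact hwU
    have h2 := (hhull T hTI y).1 (((hhull a haI y).2 h1).mono haT)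
    refine h2 ?_
    rw [← hV, ← connectedComponentIn_eq hyO]
    exact hOb
  have hsub : C ⊆ upperHP \ γ '' Icc 0 r := by
    intro y hy
    have hy' := connectedComponentIn_subset _ _ hy
    refine ⟨hy'.1, ?_⟩
    rintro ⟨x, hx, hxy⟩
    rcases le_total x a with h | h
    · exact hy'.2 ⟨x, ⟨hx.1, h⟩, hxy⟩
    · refine hdisj y hy (hxy ▸ hη x ⟨hx.1, hx.2.trans hr.2⟩ ?_)
      have : r - η / 2 ≤ a := le_max_right _ _
      rw [abs_lt]
      constructor <;> linarith [hx.2]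
  exact fun hb => hwU (hb.subset
    (isPreconnected_connectedComponentIn.subset_connectedComponentIn hwC hsub))

/-! ### No disc is filled -/

theorem isOpen_survives {l : ℝ → ℝ} (hl : Continuous l) {t : ℝ} (ht : 0 ≤ t) :
    IsOpen {z | Survives l t z} := by
  rw [isOpen_iff_mem_nhds]
  rintro z ⟨g, hg, rfl⟩
  have him := hg.im_pos t (right_mem_Icc.2 ht)
  rw [← hg.backMap_eq hl ht, ← map_nhds_backMap hl ht him, Filter.mem_map]
  filter_upwards [isOpen_upperHP.mem_nhds him] with w hw
  exact survives_backMap hl ht hw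

theorem isPreconnected_ball_diff_countable {c : ℂ} {R : ℝ} (hR : 0 < R) {Q : Set ℂ}
    (hQ : Q.Countable) : IsPreconnected (Metric.ball c R \ Q) := by
  set e := OpenPartialHomeomorph.univBall c R with he
  have hsrc : e.source = univ := OpenPartialHomeomorph.univBall_source c R
  have htgt : e.target = Metric.ball c R := OpenPartialHomeomorph.univBall_target c hR
  have hinj : InjOn e univ := hsrc ▸ e.injOn
  have hQ' : (e ⁻¹' Q).Countable := hQ.preimage_of_injOn (hinj.mono (subset_univ _))
  have hconn := (Set.Countable.isConnected_compl_of_one_lt_rank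
    (by rw [Complex.rank_real_complex]; norm_num) hQ').isPreconnected
  have himg : e '' (e ⁻¹' Q)ᶜ = Metric.ball c R \ Q := by
    ext z
    constructor
    · rintro ⟨w, hw, rfl⟩
      exact ⟨htgt ▸ e.map_source (hsrc ▸ mem_univ w), hw⟩
    · rintro ⟨hz, hzQ⟩
      rw [← htgt] at hz
      refine ⟨e.symm z, ?_, e.right_inv hz⟩
      rw [mem_compl_iff, mem_preimage, e.right_inv hz]
      exact hzQ
  rw [← himg]
  refine hconn.image e ?_
  exact e.continuousOn.mono (hsrc ▸ subset_univ _)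

theorem not_countable_ball {c : ℂ} {R : ℝ} (hR : 0 < R) : ¬ (Metric.ball c R).Countable := by
  intro h
  obtain ⟨z, hz, hzb⟩ := (h.dense_compl ℝ).exists_mem_open Metric.isOpen_ball
    (Metric.nonempty_ball.2 hR)
  exact hz hzb

/-- A driving function with small Hölder constant does not generate a curve that fills a disc. -/
theorem not_ball_subset_image {l : ℝ → ℝ} (hl : SmallHolder l) {Tm : ℝ} {γ : ℝ → ℂ}
    (hγ : ContinuousOn γ (Icc 0 Tm))
    (hhull : ∀ t ∈ Icc 0 Tm, ∀ z, Survives l t z ↔ z ∈ unboundedComponent (γ '' Icc 0 t))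
    {c : ℂ} {R : ℝ} (hR : 0 < R) (hBim : Metric.ball c R ⊆ upperHP) :
    ¬ Metric.ball c R ⊆ γ '' Icc 0 Tm := by
  intro hBγ
  have hlc := hl.continuous
  set B := Metric.ball c R with hB
  have hTm : 0 ≤ Tm := by
    obtain ⟨x, hx, -⟩ := hBγ (Metric.mem_ball_self hR)
    exact hx.1.trans hx.2
  have hdead : ∀ z ∈ B, ¬ Survives l Tm z := by
    intro z hz hs
    refine (hhull Tm ⟨hTm, le_rfl⟩ z).1 hs ?_
    rw [connectedComponentIn_eq_empty fun h => h.2 (hBγ hz)]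
    exact Bornology.isBounded_empty
  have hlife : ∀ z ∈ B, ∀ T, IsLifetime l z T → γ T = z := fun z hz T hT =>
    apply_lifetime_eq hl hγ hhull (hBim hz) (hBγ hz) hT
  choose! T hT hTle using fun z (hz : z ∈ B) => exists_isLifetime hlc (hBim hz) (hdead z hz)
  -- a time at which uncountably many points are swallowed, but not all
  obtain ⟨t, ht0, ⟨z₁, hz₁, hz₁t⟩, hA⟩ : ∃ t : ℝ, 0 ≤ t ∧ (∃ z ∈ B, Survives l t z) ∧
      ¬ {z ∈ B | ¬ Survives l t z}.Countable := by
    by_contra! hcon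
    set D : Set ℚ := {r : ℚ | (0 : ℝ) ≤ r ∧ ∃ z ∈ B, Survives l r z} with hD
    have h1 : (⋃ r ∈ D, {z ∈ B | ¬ Survives l (r : ℝ) z}).Countable :=
      D.to_countable.biUnion fun r hr => hcon r hr.1 hr.2
    -- Points with the maximal lifetime escape the rational times, but `γ` at that time is a single
    -- point. Every other point is dead at a rational time at which some point survives.
    have h2 : {z ∈ B | ∀ z' ∈ B, T z' ≤ T z}.Countable := by
      refine Set.Subsingleton.countable fun x hx y hy => ?_
      have := le_antisymm (hy.2 x hx.1) (hx.2 y hy.1)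
      rw [← hlife x hx.1 _ (hT x hx.1), this, hlife y hy.1 _ (hT y hy.1)]
    refine not_countable_ball (c := c) hR ((h1.union h2).mono fun z hz => ?_)
    by_cases hmax : ∀ z' ∈ B, T z' ≤ T z
    · exact Or.inr ⟨hz, hmax⟩
    · push Not at hmax
      obtain ⟨z', hz', hlt⟩ := hmax
      obtain ⟨r, hr1, hr2⟩ := exists_rat_btwn hlt
      refine Or.inl (mem_biUnion (show r ∈ D from
        ⟨(hT z hz).pos.le.trans hr1.le, z', hz', (hT z' hz').survives _ hr2⟩) ⟨hz, fun hs => ?_⟩)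
      exact (hT z hz).not_survives (hs.mono hr1.le)
  set W := B ∩ {z | Survives l t z} with hW
  have hWo : IsOpen W := Metric.isOpen_ball.inter (isOpen_survives hlc ht0)
  set Q := {q ∈ B | ¬ Survives l t q ∧ q ∈ closure W} with hQ
  have hQc : ¬ Q.Countable := by
    intro hcount
    obtain ⟨z₂, hz₂, hz₂Q⟩ : ∃ z ∈ {z ∈ B | ¬ Survives l t z}, z ∉ Q := by
      by_contra! h
      exact hA (hcount.mono h)
    -- Without `Q`, the disc would split into the open sets `W` and the complement of its closure,
    -- both of which it meets.
    have hpre := isPreconnected_ball_diff_countable (c := c) hR hcount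
    obtain ⟨x, -, hx1, hx2⟩ := hpre (closure W)ᶜ W isClosed_closure.isOpen_compl hWo
      (fun z hz => by
        by_cases hs : Survives l t z
        · exact Or.inr ⟨hz.1, hs⟩
        · exact Or.inl fun hc => hz.2 ⟨hz.1, hs, hc⟩)
      ⟨z₂, ⟨hz₂.1, hz₂Q⟩, fun hc => hz₂Q ⟨hz₂.1, hz₂.2, hc⟩⟩
      ⟨z₁, ⟨hz₁, fun h => h.2.1 hz₁t⟩, hz₁, hz₁t⟩
    exact hx1 (subset_closure hx2)
  choose! S hSI hSγ hScap using fun q (hq : q ∈ Q) => exists_capture_time hl ht0 hγ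
    Metric.isOpen_ball hBim hdead hlife hq.1 hq.2.1 hq.2.2
  have hcount : (S '' {q ∈ Q | t < S q}).Countable := by
    refine countable_of_capture hl (t := t) (T := Tm) ?_ ?_
    · rintro _ ⟨q, hq, rfl⟩
      exact ⟨hq.2, (hSI q hq.1).2⟩
    · rintro _ ⟨q, hq, rfl⟩
      exact hScap q hq.1 hq.2
  refine hQc (((hcount.image γ).union (countable_singleton (γ t))).mono fun q hq => ?_)
  rcases eq_or_lt_of_le (hSI q hq).1 with h | h
  · right
    rw [mem_singleton_iff, h, hSγ q hq]
  · exact Or.inl ⟨S q, ⟨q, ⟨hq, h⟩, rfl⟩, hSγ q hq⟩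

/-! ### Reduction of the theorem to a compact time interval -/

/-- A solution avoiding the driving function keeps a distance `m > 0` by compactness. Then `(Im g)²`
decays at most exponentially, and the solution cannot leave the half-plane. -/
theorem survives_iff_exists_isLoewnerSolution {lam l : ℝ → ℝ} (hl : Continuous l) {t : ℝ}
    (ht : 0 ≤ t) (heq : ∀ s ∈ Icc 0 t, l s = lam s) {z : ℂ} (hz : 0 < z.im) :
    Survives l t z ↔ ∃ g, IsLoewnerSolution lam z t g := by
  constructor
  · rintro ⟨g, hg, h0⟩
    refine ⟨g, h0, fun s hs h => ?_, fun s hs => ?_⟩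
    · have := hg.im_pos s hs
      rw [h] at this
      simp at this
    · rw [← heq s hs]
      exact hg.deriv s hs
  · rintro ⟨g, h0, hne, hd⟩
    have hd' : ∀ s ∈ Icc 0 t, HasDerivWithinAt g (2 / (g s - (l s : ℂ))) (Icc 0 t) s :=
      fun s hs => by rw [heq s hs]; exact hd s hs
    have hgc : ContinuousOn g (Icc 0 t) := fun s hs => (hd' s hs).continuousWithinAt
    have h0I : (0 : ℝ) ∈ Icc 0 t := left_mem_Icc.2 ht
    obtain ⟨s₀, hs₀, hmin⟩ := isCompact_Icc.exists_isMinOn ⟨0, h0I⟩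
      (f := fun s => ‖g s - (l s : ℂ)‖) (by fun_prop)
    set m := ‖g s₀ - (l s₀ : ℂ)‖ with hm
    have hm0 : 0 < m := norm_pos_iff.2 (sub_ne_zero.2 (heq s₀ hs₀ ▸ hne s₀ hs₀))
    have hmono : MonotoneOn (fun s => (g s).im ^ 2 * Real.exp (4 / m ^ 2 * s)) (Icc 0 t) := by
      have hder : ∀ s ∈ Icc 0 t, HasDerivWithinAt
          (fun s => (g s).im ^ 2 * Real.exp (4 / m ^ 2 * s))
          (2 * (g s).im * (-(2 * (g s).im) / (((g s).re - l s) ^ 2 + (g s).im ^ 2)) *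
            Real.exp (4 / m ^ 2 * s) +
            (g s).im ^ 2 * (Real.exp (4 / m ^ 2 * s) * (4 / m ^ 2))) (Icc 0 t) s := by
        intro s hs
        have h1 : HasDerivWithinAt (fun s => (g s).im)
            (2 / (g s - (l s : ℂ))).im (Icc 0 t) s :=
          Complex.imCLM.hasFDerivAt.comp_hasDerivWithinAt s (hd' s hs)
        rw [two_div_sub_ofReal_im] at h1
        have h2 := (hasDerivWithinAt_id s (Icc 0 t)).const_mul (4 / m ^ 2)
        rw [mul_one] at h2
        refine ((h1.pow 2).mul h2.exp).congr_deriv ?_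
        simp
      refine monotoneOn_of_hasDerivWithinAt_nonneg (convex_Icc 0 t)
        (fun s hs => (hder s hs).continuousWithinAt)
        (fun s hs => (hder s (interior_subset hs)).mono interior_subset) ?_
      intro s hs
      have hs' := interior_subset hs
      have hn : m ^ 2 ≤ ((g s).re - l s) ^ 2 + (g s).im ^ 2 := by
        have h1 : m ^ 2 ≤ ‖g s - (l s : ℂ)‖ ^ 2 := pow_le_pow_left₀ hm0.le (hmin hs') 2
        rw [Complex.sq_norm (g s - _), Complex.normSq_apply] at h1
        simp only [Complex.sub_re, Complex.ofReal_re, Complex.sub_im, Complex.ofReal_im,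
          sub_zero] at h1
        linarith
      have h2 : 4 * (g s).im ^ 2 / (((g s).re - l s) ^ 2 + (g s).im ^ 2) ≤
          4 * (g s).im ^ 2 / m ^ 2 := by gcongr
      have h3 : 0 ≤ Real.exp (4 / m ^ 2 * s) * (4 * (g s).im ^ 2 / m ^ 2 -
          4 * (g s).im ^ 2 / (((g s).re - l s) ^ 2 + (g s).im ^ 2)) :=
        mul_nonneg (Real.exp_pos _).le (by linarith)
      calc (0 : ℝ) ≤ _ := h3
        _ = _ := by ring
    have himne : ∀ s ∈ Icc 0 t, (g s).im ≠ 0 := by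
      intro s hs h
      have := hmono h0I hs hs.1
      simp only [h, h0, mul_zero, Real.exp_zero, mul_one] at this
      have : 0 < z.im ^ 2 := by positivity
      norm_num at *
      linarith
    refine ⟨g, ⟨hd', fun s hs => ?_⟩, h0⟩
    by_contra hle
    obtain ⟨x, hx, hx0⟩ := intermediate_value_Icc' (f := fun s => (g s).im) hs.1
      (Complex.continuous_im.comp_continuousOn (hgc.mono (Icc_subset_Icc le_rfl hs.2)))
      (show (0 : ℝ) ∈ Icc (g s).im (g 0).im from ⟨not_lt.1 hle, by rw [h0]; exact hz.le⟩)
    exact himne x ⟨hx.1, hx.2.trans hs.2⟩ hx0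

/-- If the image of an interval has non-empty interior, then so has that of a compact
subinterval. -/
theorem exists_interior_image_Icc_nonempty {J : Set ℝ} (hJ : J.OrdConnected) (hJ0 : IsLeast J 0)
    {γ : ℝ → ℂ} (hγ : ContinuousOn γ J) (hint : (interior (γ '' J)).Nonempty) :
    ∃ T ∈ J, (interior (γ '' Icc 0 T)).Nonempty := by
  have hsub : ∀ T ∈ J, Icc 0 T ⊆ J := fun T hT => hJ.out hJ0.1 hT
  by_cases hmax : ∃ T ∈ J, ∀ x ∈ J, x ≤ T
  · obtain ⟨T, hT, hx⟩ := hmax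
    refine ⟨T, hT, ?_⟩
    rwa [show Icc 0 T = J from (hsub T hT).antisymm fun x hxJ => ⟨hJ0.2 hxJ, hx x hxJ⟩]
  · push Not at hmax
    by_contra! hcon
    -- By Baire, countably many compact sets with empty interior cannot cover an open set.
    have hcover : γ '' J ⊆ ⋃ r : {r : ℚ // (r : ℝ) ∈ J}, γ '' Icc 0 (r : ℝ) := by
      rintro _ ⟨x, hx, rfl⟩
      obtain ⟨y, hy, hxy⟩ := hmax x hx
      obtain ⟨r, hr1, hr2⟩ := exists_rat_btwn hxy
      exact mem_iUnion.2 ⟨⟨r, hJ.out hx hy ⟨hr1.le, hr2.le⟩⟩, x, ⟨hJ0.2 hx, hr1.le⟩, rfl⟩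
    have hmeagre : IsMeagre (⋃ r : {r : ℚ // (r : ℝ) ∈ J}, γ '' Icc 0 (r : ℝ)) := by
      refine isMeagre_iUnion fun r => IsNowhereDense.isMeagre ?_
      have hcl : IsClosed (γ '' Icc 0 (r : ℝ)) :=
        (isCompact_Icc.image_of_continuousOn (hγ.mono (hsub _ r.2))).isClosed
      rw [hcl.isNowhereDense_iff]
      exact hcon _ r.2
    exact not_isMeagre_of_isOpen isOpen_interior hint
      (hmeagre.mono (interior_subset.trans hcover))

theorem interior_setOf_im_nonneg_subset : interior {z : ℂ | 0 ≤ z.im} ⊆ upperHP := by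
  rw [Complex.interior_setOfPred_le_im]
  exact subset_rfl

/-- A Lip(1/2) driving function, on an interval of times that starts at `0`, that generates a
curve with non-empty interior has Lip(1/2) norm at least `4.0001`. The Lip(1/2) norm is the
best Hölder constant of exponent `1/2`. -/
theorem theorem1p1 (J : Set ℝ) (hJ : J.OrdConnected) (hJ0 : IsLeast J 0)
    (lam : ℝ → ℝ) (hlam : MemHolder (1 / 2) (fun t : J => lam t))
    (γ : ℝ → ℂ) (hγ : GeneratesCurve lam J γ)
    (hint : (interior (γ '' J)).Nonempty) :
    (4.0001 : ℝ) ≤ (nnHolderNorm (1 / 2) (fun t : J => lam t) : ℝ) := by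
  by_contra hlt
  rw [not_le] at hlt
  obtain ⟨T, hTJ, z, hz⟩ := exists_interior_image_Icc_nonempty hJ hJ0 hγ.continuousOn hint
  have hT0 : 0 ≤ T := hJ0.2 hTJ
  have hsub : Icc 0 T ⊆ J := hJ.out hJ0.1 hTJ
  -- Constant extension beyond `[0, T]` keeps the Hölder constant, because the projection is
  -- 1-Lipschitz.
  set l : ℝ → ℝ := fun s => lam (projIcc 0 T hT0 s) with hldef
  have hl : SmallHolder l := by
    intro s t
    have h1 := hlam.holderWith.dist_le ⟨projIcc 0 T hT0 s, hsub (projIcc 0 T hT0 s).2⟩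
      ⟨projIcc 0 T hT0 t, hsub (projIcc 0 T hT0 t).2⟩
    have h2 : dist (projIcc 0 T hT0 s : ℝ) (projIcc 0 T hT0 t : ℝ) ≤ |s - t| := by
      have := (LipschitzWith.projIcc hT0).dist_le_mul s t
      rw [NNReal.coe_one, one_mul, Subtype.dist_eq, Real.dist_eq s t] at this
      exact this
    rw [Real.dist_eq, Subtype.dist_eq] at h1
    refine h1.trans ?_
    rw [Real.sqrt_eq_rpow]
    push_cast
    gcongr
    exact h2
  have heq : ∀ s ∈ Icc 0 T, l s = lam s := fun s hs => by simp only [hldef, projIcc_of_mem hT0 hs]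
  obtain ⟨R, hR, hball⟩ := Metric.isOpen_iff.1 isOpen_interior z hz
  have hBγ : Metric.ball z R ⊆ γ '' Icc 0 T := hball.trans interior_subset
  have hBim : Metric.ball z R ⊆ upperHP := by
    refine (interior_maximal ?_ Metric.isOpen_ball).trans interior_setOf_im_nonneg_subset
    intro w hw
    obtain ⟨x, hx, rfl⟩ := hBγ hw
    exact hγ.im_nonneg x (hsub hx)
  refine not_ball_subset_image hl (hγ.continuousOn.mono hsub) (fun t ht w => ?_) hR hBim hBγ
  by_cases hw : w ∈ upperHP
  · rw [survives_iff_exists_isLoewnerSolution hl.continuous ht.1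
      (fun s hs => heq s ⟨hs.1, hs.2.trans ht.2⟩) hw]
    have hh := congrArg (w ∈ ·) (hγ.hull_eq t (hsub ht))
    simp only [loewnerHull, mem_ofPred_eq, mem_sdiff, hw, true_and, eq_iff_iff] at hh
    exact not_iff_not.1 hh
  · constructor
    · rintro ⟨g, hg, rfl⟩
      exact absurd (hg.im_pos 0 (left_mem_Icc.2 ht.1)) hw
    · intro h
      refine absurd ?_ h
      rw [connectedComponentIn_eq_empty fun h => hw h.1]
      exact Bornology.isBounded_empty
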